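/- Let $K\ge 1$, $\mathcal A=\{1,\dots,K\}$, and equip the full shift $\Sigma=\mathcal A^{\mathbb N}$ ($\mathbb N=\{0,1,2,\dots\}$) with the shift map $(\sigma x)_i=x_{i+1}$ and the metric $\rho(x,y)=K^{-\min\{n\ge 0:\,x_n\ne y_n\}}$ for $x\neq y$, $\rho(x,x)=0$. Let $A$ be a $K\times K$ matrix with entries in $\{0,1\}$, and let $\Sigma_A=\{x\in\Sigma: A_{x_i,x_{i+1}}=1\text{ for all } i\in\mathbb N\}$. Assume that $\Sigma_A$ is aperiodic and irreducible, that is, there is $r>0$ such that every entry of $A^r$ is strictly positive. For $\omega\in\Sigma_A$, let $\mathrm{ML}_\omega(\Sigma_A,\sigma)$ be the set of all $x\in\Sigma_A$ with $$\liminf_{n\to\infty}\frac1n\sum_{i=0}^{n-1}\rho(\sigma^i\omega,\sigma^ix)=0\quad\text{and}\quad\limsup_{n\to\infty}\frac1n\sum_{i=0}^{n-1}\rho(\sigma^i\omega,\sigma^ix)>0 .$$ For a finite word $W$ over $\mathcal A$ let $|W|$ be its length and $[W]\subset\Sigma$ its cylinder. For $Z\subset\Sigma$ and $s\ge0$: -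 $\mathcal H^s(Z)=\lim_{N\to\infty}\inf_{\mathcal W}\sum_{W\in\mathcal W}e^{-s|W|}$, where the infimum is over all covers $\mathcal W$ of $Z$ by cylinders of length larger than $N$; the Bowen entropy is $h^B(Z)=\inf\{s\ge0:\mathcal H^s(Z)=0\}$. - $\mathcal P^s_*(Z)=\lim_{N\to\infty}\sup_{\mathcal W}\sum_{W\in\mathcal W}e^{-s|W|}$, where the supremum is over all families $\mathcal W$ of pairwise disjoint cylinders of length at least $N$ that meet $Z$; $\mathcal P^s(Z)=\inf\{\sum_{i\in\mathbb N}\mathcal P^s_*(Z_i):Z\subset\bigcup_{i\in\mathbb N} Z_i\}$; the packing entropy is $h^P(Z)=\inf\{s\ge0:\mathcal P^s(Z)=0\}$. Let $h(\Sigma_A)$ be the topological entropy of $(\Sigma_A,\sigma)$, and let $\dim_H$ and $\dim_P$ be the Hausdorff and packing dimensions with respect to $\rho$. Then for every $\omega\in\Sigma_A$, $$h^B(\mathrm{ML}_\omega(\Sigma_A,\sigma))=0\quad\text{and}\quad h^P(\mathrm{ML}_\omega(\Sigma_A,\sigma))=h(\Sigma_A),$$ and likewise $$\dim_H(\mathrm{ML}_\omega(\Sigma_A,\sigma))=0\quad\text{and}\quad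 \dim_P(\mathrm{ML}_\omega(\Sigma_A,\sigma))=\dim_H(\Sigma_A).$$ -/

import Mathlib

open Filter
open scoped NNReal ENNReal

namespace Shift

/-- The full shift `Σ = 𝒜^ℕ` on the alphabet `𝒜 = Fin K` with `K` letters. -/
@[ext] structure FullShift (K : ℕ) : Type where
  /-- The sequence of letters. -/
  seq : ℕ → Fin K

variable {K : ℕ}

instance : CoeFun (FullShift K) fun _ => ℕ → Fin K where
  coe := FullShift.seq

/-- The metric `ρ(x, y) = K ^ (-min {n : x n ≠ y n})` for `x ≠ y`, and `ρ(x, x) = 0`. -/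
noncomputable instance : Dist (FullShift K) where
  dist x y := open Classical in
    if x = y then 0 else ((K : ℝ)⁻¹) ^ PiNat.firstDiff x.seq y.seq

theorem dist_of_ne {x y : FullShift K} (h : x ≠ y) :
    dist x y = ((K : ℝ)⁻¹) ^ PiNat.firstDiff x.seq y.seq := if_neg h

theorem dist_self' (x : FullShift K) : dist x x = 0 := if_pos rfl

theorem dist_nonneg' (x y : FullShift K) : 0 ≤ dist x y := by
  by_cases h : x = y
  · subst h; rw [dist_self']
  · rw [dist_of_ne h]; positivity

theorem one_le_card (x : FullShift K) : 1 ≤ K := (Nat.zero_le _).trans_lt (x 0).2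

theorem dist_triangle_max (x y z : FullShift K) : dist x z ≤ max (dist x y) (dist y z) := by
  by_cases hxz : x = z
  · subst hxz; rw [dist_self']; exact le_max_of_le_left (dist_nonneg' _ _)
  by_cases hxy : x = y
  · subst hxy; exact le_max_right _ _
  by_cases hyz : y = z
  · subst hyz; exact le_max_left _ _
  rw [dist_of_ne hxz, dist_of_ne hxy, dist_of_ne hyz]
  have hK : (1 : ℝ) ≤ K := by exact_mod_cast one_le_card x
  have h0 : (0 : ℝ) ≤ (K : ℝ)⁻¹ := by positivity
  have h1 : (K : ℝ)⁻¹ ≤ 1 := inv_le_one_of_one_le₀ hK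
  rcases min_le_iff.1 (PiNat.min_firstDiff_le x.seq y.seq z.seq fun h => hxz (FullShift.ext h)) with h | h
  · exact le_max_of_le_left (pow_le_pow_of_le_one h0 h1 h)
  · exact le_max_of_le_right (pow_le_pow_of_le_one h0 h1 h)

noncomputable instance : MetricSpace (FullShift K) where
  dist_self := dist_self'
  dist_comm x y := by
    by_cases h : x = y
    · rw [h]
    · rw [dist_of_ne h, dist_of_ne (Ne.symm h), PiNat.firstDiff_comm]
  dist_triangle x y z := (dist_triangle_max x y z).trans
    (max_le_add_of_nonneg (dist_nonneg' _ _) (dist_nonneg' _ _))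
  eq_of_dist_eq_zero {x y} h := by
    by_contra hne
    have hK : (0 : ℝ) < K := by exact_mod_cast one_le_card x
    rw [dist_of_ne hne] at h
    have : (0 : ℝ) < ((K : ℝ)⁻¹) ^ PiNat.firstDiff x.seq y.seq := by positivity
    exact this.ne' h

/-- The shift map `(σ x) i = x (i + 1)`. -/
def shift (x : FullShift K) : FullShift K := ⟨fun i => x (i + 1)⟩

/-- The shift of finite type `Σ_A = {x : A (x i) (x (i + 1)) = 1 for each i}`, as a subset of the
full shift. -/
def SFT (A : Matrix (Fin K) (Fin K) ℕ) : Set (FullShift K) :=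
  {x | ∀ i : ℕ, A (x i) (x (i + 1)) = 1}

/-- `A` is aperiodic and irreducible: some positive power of `A` has only positive entries. -/
def IsAperiodicIrreducible (A : Matrix (Fin K) (Fin K) ℕ) : Prop :=
  ∃ r : ℕ, 0 < r ∧ ∀ i j, 0 < (A ^ r) i j

/-- The cylinder `[W]` in the full shift. -/
def cylinder (W : List (Fin K)) : Set (FullShift K) :=
  {x | ∀ i : Fin W.length, x i = W.get i}

/-- The topological entropy `h(Z)` of a shift-invariant closed set `Z`, by Bowen's definition
through minimal spanning sets. -/
noncomputable def topEntropy (Z : Set (FullShift K)) : EReal :=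
  Dynamics.coverEntropy (shift : FullShift K → FullShift K) Z

section MeanLiYorke

variable {X : Type*} [MetricSpace X]

/-- `(1 / n) ∑_{i < n} ρ(T^i x, T^i y)`. -/
noncomputable def meanDist (T : X → X) (x y : X) (n : ℕ) : ℝ :=
  (1 / (n : ℝ)) * ∑ i ∈ Finset.range n, dist (T^[i] x) (T^[i] y)

/-- Mean Li-Yorke pairs of a system with bounded metric. -/
def IsMeanLiYorkePair (T : X → X) (x y : X) : Prop :=
  liminf (meanDist T x y) atTop = 0 ∧ 0 < limsup (meanDist T x y) atTop

end MeanLiYorke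

/-- `ML_ω(Σ_A, σ)`: the points of `Σ_A` that form a mean Li-Yorke pair with `ω`. -/
def ML (A : Matrix (Fin K) (Fin K) ℕ) (ω : FullShift K) : Set (FullShift K) :=
  {x | x ∈ SFT A ∧ IsMeanLiYorkePair shift ω x}

/-- `e ^ (-s |W|)`. -/
noncomputable def weight (s : ℝ≥0) (W : List (Fin K)) : ℝ≥0∞ :=
  ENNReal.ofReal (Real.exp (-((s : ℝ) * (W.length : ℝ))))

/-- `ℋ^s_N(Z)`: infimum of `∑ e ^ (-s |W|)` over the covers of `Z` by cylinders of length larger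
than `N`. -/
noncomputable def bowenPre (s : ℝ≥0) (N : ℕ) (Z : Set (FullShift K)) : ℝ≥0∞ :=
  ⨅ (𝒲 : Set (List (Fin K))) (_ : ∀ W ∈ 𝒲, N < W.length) (_ : Z ⊆ ⋃ W ∈ 𝒲, cylinder W),
    ∑' W : 𝒲, weight s (W : List (Fin K))

/-- `ℋ^s(Z) = lim_N ℋ^s_N(Z)`, a limit of a sequence that is nondecreasing in `N`. -/
noncomputable def bowenMeasure (s : ℝ≥0) (Z : Set (FullShift K)) : ℝ≥0∞ :=
  ⨆ N : ℕ, bowenPre s N Z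

/-- The Bowen entropy `h^B(Z) = inf {s ≥ 0 : ℋ^s(Z) = 0}`. -/
noncomputable def bowenEntropy (Z : Set (FullShift K)) : ℝ≥0∞ :=
  ⨅ (s : ℝ≥0) (_ : bowenMeasure s Z = 0), (s : ℝ≥0∞)

/-- `𝒫^s_N(Z)`: supremum of `∑ e ^ (-s |W|)` over the families of pairwise disjoint cylinders of
length at least `N` that meet `Z`. -/
noncomputable def packingPre (s : ℝ≥0) (N : ℕ) (Z : Set (FullShift K)) : ℝ≥0∞ :=
  ⨆ (𝒲 : Set (List (Fin K))) (_ : ∀ W ∈ 𝒲, N ≤ W.length ∧ (cylinder W ∩ Z).Nonempty)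
    (_ : 𝒲.PairwiseDisjoint cylinder), ∑' W : 𝒲, weight s (W : List (Fin K))

/-- `𝒫^s_*(Z) = lim_N 𝒫^s_N(Z)`, a limit of a sequence that is nonincreasing in `N`. -/
noncomputable def packingLim (s : ℝ≥0) (Z : Set (FullShift K)) : ℝ≥0∞ :=
  ⨅ N : ℕ, packingPre s N Z

/-- `𝒫^s(Z)`: infimum of `∑_i 𝒫^s_*(Z_i)` over the countable covers of `Z`. -/
noncomputable def packingMeasure (s : ℝ≥0) (Z : Set (FullShift K)) : ℝ≥0∞ :=
  ⨅ (Y : ℕ → Set (FullShift K)) (_ : Z ⊆ ⋃ i, Y i), ∑' i, packingLim s (Y i)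

/-- The packing entropy `h^P(Z) = inf {s ≥ 0 : 𝒫^s(Z) = 0}`. -/
noncomputable def packingEntropy (Z : Set (FullShift K)) : ℝ≥0∞ :=
  ⨅ (s : ℝ≥0) (_ : packingMeasure s Z = 0), (s : ℝ≥0∞)

section PackingDimension

variable {X : Type*} [MetricSpace X]

/-- The packing premeasure at scale `δ`: supremum of `∑ (2 r) ^ s` over the families of pairwise
disjoint closed balls of radius `0 < r ≤ δ` centred in `E`. -/
noncomputable def ballPackingPre (s δ : ℝ≥0) (E : Set X) : ℝ≥0∞ :=
  ⨆ (ℬ : Set (X × ℝ≥0)) (_ : ∀ b ∈ ℬ, b.1 ∈ E ∧ 0 < b.2 ∧ b.2 ≤ δ)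
    (_ : ℬ.PairwiseDisjoint fun b => Metric.closedBall b.1 (b.2 : ℝ)),
    ∑' b : ℬ, ((2 * b.1.2 : ℝ≥0) : ℝ≥0∞) ^ (s : ℝ)

/-- The packing premeasure: the limit of `ballPackingPre s δ E` as `δ` decreases to `0`. -/
noncomputable def ballPackingLim (s : ℝ≥0) (E : Set X) : ℝ≥0∞ :=
  ⨅ (δ : ℝ≥0) (_ : 0 < δ), ballPackingPre s δ E

/-- The `s`-dimensional packing (outer) measure. -/
noncomputable def ballPackingMeasure (s : ℝ≥0) (E : Set X) : ℝ≥0∞ :=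
  ⨅ (Y : ℕ → Set X) (_ : E ⊆ ⋃ i, Y i), ∑' i, ballPackingLim s (Y i)

/-- The packing dimension of a subset of a metric space. -/
noncomputable def dimP (E : Set X) : ℝ≥0∞ :=
  ⨅ (s : ℝ≥0) (_ : ballPackingMeasure s E = 0), (s : ℝ≥0∞)

end PackingDimension

end Shift

/-!
# Entropy and dimension of mean Li–Yorke sets in a shift of finite type

Over at least two letters, cylinders are balls: a cylinder of length `n` is a closed ball of radius
`K ^ (-n)`, so that `exp (-s |W|)` is the `s / log K`-th power of the radius of `[W]`. Hence, for
every subset of the full shift, `dim_H · log K` is the Bowen entropy (`dimH_mul_logCard`) and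
`dim_P · log K` is the packing entropy (`dimP_mul_logCard`), and the claims on dimensions follow
from those on entropies together with `h^B(Σ_A) = h(Σ_A)`. The last equality holds for all compact
invariant sets (`bowenEntropy_eq_topEntropy`); no measure is needed for its lower bound, since a
finite cover by cylinders of total weight at most one yields a linear recursion for the number of
words of the language.

The Bowen entropy of `ML_ω` vanishes (`bowenEntropy_ML`) because `liminf = 0` puts infinitely many
prefixes of `x` in Hamming balls of small relative radius around the prefixes of `ω`, and the number
of words in these balls grows at an arbitrarily small exponential rate.

The packing entropy of `ML_ω` is at most `h(Σ_A)` by counting words. It is at least `h(Σ_A)`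
(`topEntropy_le_packingEntropy_ML`) because `ML_ω` contains a dense `Gδ` subset of `Σ_A`
(`exists_dense_Gδ_subset_ML`, by gluing orbits along paths given by a positive power of `A`): if
countably many sets cover `ML_ω`, by Baire's theorem the closure of one of them contains a cylinder
of `Σ_A`, and the packing premeasure, which does not distinguish a set from its closure, is infinite
on it for each exponent below `h(Σ_A)` (`packingLim_eq_top`).

A one-letter alphabet is treated apart: there `ML_ω` is empty and `Σ_A` is a point.
-/

open Set Topology MeasureTheory

namespace Shift

variable {K : ℕ}

/-! ### Cylinders and the topology of the full shift -/

/-- The word formed by the first `n` letters of `x`. -/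
def prefixWord (n : ℕ) (x : FullShift K) : List (Fin K) := List.ofFn fun i : Fin n => x i

@[simp] theorem length_prefixWord (n : ℕ) (x : FullShift K) : (prefixWord n x).length = n := by
  simp [prefixWord]

theorem prefixWord_eq_iff {n : ℕ} {x y : FullShift K} :
    prefixWord n x = prefixWord n y ↔ ∀ i < n, x i = y i := by
  rw [prefixWord, prefixWord, List.ofFn_inj, funext_iff, Fin.forall_iff]

theorem mem_cylinder_iff {x : FullShift K} {W : List (Fin K)} :
    x ∈ cylinder W ↔ prefixWord W.length x = W := by
  constructor
  · intro h
    conv_rhs => rw [← List.ofFn_get W]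
    exact congrArg List.ofFn (funext h)
  · intro h i
    have h' : List.ofFn (fun i : Fin W.length => x i) = List.ofFn W.get := by
      rw [List.ofFn_get]; exact h
    exact congrFun (List.ofFn_inj.1 h') i

theorem mem_cylinder_prefixWord {n : ℕ} {x y : FullShift K} :
    y ∈ cylinder (prefixWord n x) ↔ ∀ i < n, y i = x i := by
  rw [mem_cylinder_iff, length_prefixWord, prefixWord_eq_iff]

theorem self_mem_cylinder_prefixWord (n : ℕ) (x : FullShift K) :
    x ∈ cylinder (prefixWord n x) := mem_cylinder_prefixWord.2 fun _ _ => rfl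

theorem eq_of_cylinder_inter {V W : List (Fin K)} (hl : V.length = W.length) {x : FullShift K}
    (hV : x ∈ cylinder V) (hW : x ∈ cylinder W) : V = W := by
  rw [← mem_cylinder_iff.1 hV, ← mem_cylinder_iff.1 hW, hl]

theorem dist_le_of_agree {n : ℕ} {x y : FullShift K} (h : ∀ i < n, x i = y i) :
    dist x y ≤ ((K : ℝ)⁻¹) ^ n := by
  by_cases hxy : x = y
  · rw [hxy, dist_self]; positivity
  rw [dist_of_ne hxy]
  have hK : (1 : ℝ) ≤ K := by exact_mod_cast one_le_card x
  refine pow_le_pow_of_le_one (by positivity) (inv_le_one_of_one_le₀ hK) ?_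
  by_contra! hlt
  exact PiNat.apply_firstDiff_ne (fun h => hxy (FullShift.ext h)) (h _ hlt)

theorem dist_le_one (x y : FullShift K) : dist x y ≤ 1 := by
  simpa using dist_le_of_agree (n := 0) (x := x) (y := y) (by simp)

theorem dist_eq_one_of_ne {x y : FullShift K} (h : x 0 ≠ y 0) : dist x y = 1 := by
  have hxy : x ≠ y := fun h' => h (by rw [h'])
  have : PiNat.firstDiff x.seq y.seq = 0 := by
    by_contra h0
    exact h (PiNat.apply_eq_of_lt_firstDiff (Nat.pos_of_ne_zero h0))
  rw [dist_of_ne hxy, this, pow_zero]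

theorem inv_card_lt_one (hK : 2 ≤ K) : (K : ℝ)⁻¹ < 1 :=
  inv_lt_one_of_one_lt₀ (by exact_mod_cast hK)

theorem inv_card_pos (hK : 2 ≤ K) : 0 < (K : ℝ)⁻¹ :=
  inv_pos.2 (by exact_mod_cast (by lia : 0 < K))

theorem dist_le_pow_iff (hK : 2 ≤ K) {n : ℕ} {x y : FullShift K} :
    dist x y ≤ ((K : ℝ)⁻¹) ^ n ↔ ∀ i < n, x i = y i := by
  refine ⟨fun h i hi => ?_, dist_le_of_agree⟩
  by_cases hxy : x = y
  · rw [hxy]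
  rw [dist_of_ne hxy] at h
  have := (pow_le_pow_iff_right_of_lt_one₀ (inv_card_pos hK) (inv_card_lt_one hK)).1 h
  exact PiNat.apply_eq_of_lt_firstDiff (hi.trans_le this)

theorem closedBall_pow (hK : 2 ≤ K) (x : FullShift K) (n : ℕ) :
    Metric.closedBall x (((K : ℝ)⁻¹) ^ n) = cylinder (prefixWord n x) := by
  ext y
  rw [Metric.mem_closedBall, dist_le_pow_iff hK, mem_cylinder_prefixWord]

theorem isOpen_cylinder (hK : 2 ≤ K) (W : List (Fin K)) : IsOpen (cylinder W) := by
  rw [isOpen_iff_mem_nhds]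
  intro x hx
  rw [← mem_cylinder_iff.1 hx, ← closedBall_pow hK]
  exact Metric.closedBall_mem_nhds x (pow_pos (inv_card_pos hK) _)

theorem exists_cylinder_subset (hK : 2 ≤ K) {x : FullShift K} {U : Set (FullShift K)}
    (hU : U ∈ 𝓝 x) : ∃ n, cylinder (prefixWord n x) ⊆ U := by
  obtain ⟨ε, hε, h⟩ := Metric.nhds_basis_closedBall.mem_iff.1 hU
  obtain ⟨n, hn⟩ := exists_pow_lt_of_lt_one hε (inv_card_lt_one hK)
  refine ⟨n, ?_⟩
  rw [← closedBall_pow hK]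
  exact (Metric.closedBall_subset_closedBall hn.le).trans h

theorem continuous_eval (hK : 2 ≤ K) (i : ℕ) : Continuous fun x : FullShift K => x i := by
  rw [continuous_discrete_rng]
  intro a
  rw [isOpen_iff_mem_nhds]
  intro x hx
  refine mem_of_superset ((isOpen_cylinder hK (prefixWord (i + 1) x)).mem_nhds
    (self_mem_cylinder_prefixWord _ _)) fun y hy => ?_
  rw [mem_preimage, mem_cylinder_prefixWord.1 hy i (by lia)]
  exact hx

theorem continuous_mk (hK : 2 ≤ K) : Continuous (FullShift.mk : (ℕ → Fin K) → FullShift K) := by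
  rw [continuous_iff_continuousAt]
  intro x U hU
  obtain ⟨n, hn⟩ := exists_cylinder_subset hK hU
  have : (⋂ i ∈ Finset.range n, {y : ℕ → Fin K | y i = x i}) ∈ 𝓝 x := by
    refine (Filter.biInter_finset_mem _).2 fun i _ => ?_
    exact (continuous_apply i).continuousAt.preimage_mem_nhds
      ((isOpen_discrete {x i}).mem_nhds rfl)
  rw [mem_map]
  filter_upwards [this] with y hy
  refine hn (mem_cylinder_prefixWord.2 fun i hi => ?_)
  simpa using mem_iInter₂.1 hy i (Finset.mem_range.2 hi)

theorem continuous_shift (hK : 2 ≤ K) : Continuous (shift : FullShift K → FullShift K) :=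
  (continuous_mk hK).comp (continuous_pi fun i => continuous_eval hK (i + 1))

theorem isCompact_SFT (hK : 2 ≤ K) (A : Matrix (Fin K) (Fin K) ℕ) : IsCompact (SFT A) := by
  have hc : IsCompact (univ : Set (FullShift K)) := by
    rw [← image_univ_of_surjective (f := (FullShift.mk : (ℕ → Fin K) → FullShift K))
      fun x => ⟨x.seq, rfl⟩]
    exact isCompact_univ.image (continuous_mk hK)
  refine hc.of_isClosed_subset ?_ (subset_univ _)
  rw [SFT, ofPred_forall]
  refine isClosed_iInter fun i => ?_
  have : Continuous fun x : FullShift K => (x i, x (i + 1)) :=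
    (continuous_eval hK i).prodMk (continuous_eval hK (i + 1))
  exact (isClosed_discrete {p : Fin K × Fin K | A p.1 p.2 = 1}).preimage this

theorem shift_iterate_apply (k : ℕ) (x : FullShift K) (i : ℕ) : (shift^[k] x) i = x (k + i) := by
  induction k generalizing x with
  | zero => simp
  | succ k ih =>
    rw [Function.iterate_succ_apply, ih]
    exact congrArg x.seq (by lia)

theorem shift_iterate_mem_SFT {A : Matrix (Fin K) (Fin K) ℕ} {x : FullShift K} (hx : x ∈ SFT A)
    (k : ℕ) : shift^[k] x ∈ SFT A := by
  intro i
  rw [shift_iterate_apply, shift_iterate_apply]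
  exact hx (k + i)

/-! ### The language of a set -/

/-- The words of length `n` that occur as prefixes of points of `Z`. -/
def language (n : ℕ) (Z : Set (FullShift K)) : Set (List (Fin K)) := prefixWord n '' Z

theorem length_of_mem_language {n : ℕ} {Z : Set (FullShift K)} {W : List (Fin K)}
    (h : W ∈ language n Z) : W.length = n := by
  obtain ⟨x, -, rfl⟩ := h
  simp

theorem finite_language (n : ℕ) (Z : Set (FullShift K)) : (language n Z).Finite :=
  (List.finite_length_eq (Fin K) n).subset fun _ h => length_of_mem_language h

theorem mem_language_of_cylinder_inter {W : List (Fin K)} {Z : Set (FullShift K)}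
    (h : (cylinder W ∩ Z).Nonempty) : W ∈ language W.length Z := by
  obtain ⟨x, hx, hZ⟩ := h
  exact ⟨x, hZ, mem_cylinder_iff.1 hx⟩

theorem cylinder_inter_nonempty {n : ℕ} {W : List (Fin K)} {Z : Set (FullShift K)}
    (h : W ∈ language n Z) : (cylinder W ∩ Z).Nonempty := by
  obtain ⟨x, hx, rfl⟩ := h
  exact ⟨x, self_mem_cylinder_prefixWord n x, hx⟩

/-- Summing the weights over a set of words of length `n` multiplies `exp (-s n)` by the number
of words. -/
theorem tsum_weight_of_length {n : ℕ} {S : Set (List (Fin K))} (hS : ∀ W ∈ S, W.length = n)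
    (s : ℝ≥0) : ∑' W : S, weight s (W : List (Fin K)) =
      (S.ncard : ℝ≥0∞) * ENNReal.ofReal (Real.exp (-((s : ℝ) * n))) := by
  have hfin : S.Finite := (List.finite_length_eq (Fin K) n).subset hS
  have : ∀ W : S, weight s (W : List (Fin K)) = ENNReal.ofReal (Real.exp (-((s : ℝ) * n))) :=
    fun W => by rw [weight, hS _ W.2]
  simp_rw [this]
  rw [ENNReal.tsum_const, ENat.card_coe_set_eq, ← hfin.cast_ncard_eq]
  simp

/-! ### Dimension and entropy -/

/-- `log K` as a nonnegative real: the factor between dimension and entropy. -/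
noncomputable def logCard (K : ℕ) : ℝ≥0 := (Real.log K).toNNReal

theorem logCard_pos (hK : 2 ≤ K) : 0 < logCard K :=
  Real.toNNReal_pos.2 (Real.log_pos (by exact_mod_cast hK))

theorem coe_logCard (hK : 2 ≤ K) : (logCard K : ℝ) = Real.log K :=
  Real.coe_toNNReal _ (Real.log_nonneg (by exact_mod_cast (by lia : 1 ≤ K)))

theorem weight_eq (hK : 2 ≤ K) (d : ℝ≥0) (W : List (Fin K)) :
    weight (d * logCard K) W = ENNReal.ofReal (((K : ℝ)⁻¹) ^ W.length) ^ (d : ℝ) := by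
  have h0 : (0 : ℝ) < K := by exact_mod_cast (by lia : 0 < K)
  rw [ENNReal.ofReal_rpow_of_nonneg (by positivity) d.coe_nonneg, weight, NNReal.coe_mul,
    coe_logCard hK, Real.rpow_def_of_pos (by positivity), Real.log_pow, Real.log_inv]
  congr 2
  ring

theorem ediam_cylinder_le (W : List (Fin K)) :
    Metric.ediam (cylinder W) ≤ ENNReal.ofReal (((K : ℝ)⁻¹) ^ W.length) := by
  refine Metric.ediam_le fun x hx y hy => ?_
  rw [edist_dist]
  refine ENNReal.ofReal_le_ofReal (dist_le_of_agree ?_)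
  rw [← prefixWord_eq_iff, mem_cylinder_iff.1 hx, mem_cylinder_iff.1 hy]

theorem tendsto_ofReal_inv_card_pow (hK : 2 ≤ K) :
    Tendsto (fun n => ENNReal.ofReal (((K : ℝ)⁻¹) ^ n)) atTop (𝓝 0) := by
  rw [← ENNReal.ofReal_zero]
  exact ENNReal.tendsto_ofReal
    (tendsto_pow_atTop_nhds_zero_of_lt_one (inv_card_pos hK).le (inv_card_lt_one hK))

theorem hausdorffMeasure_eq_zero_of_bowenMeasure [MeasurableSpace (FullShift K)]
    [BorelSpace (FullShift K)] (hK : 2 ≤ K) {d : ℝ≥0} {Z : Set (FullShift K)}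
    (h : bowenMeasure (d * logCard K) Z = 0) : μH[d] Z = 0 := by
  have hpre : ∀ N : ℕ, ∃ 𝒲 : Set (List (Fin K)), (∀ W ∈ 𝒲, N < W.length) ∧
      (Z ⊆ ⋃ W ∈ 𝒲, cylinder W) ∧
      ∑' W : 𝒲, weight (d * logCard K) (W : List (Fin K)) < ((N : ℝ≥0∞) + 1)⁻¹ := by
    intro N
    have h0 : bowenPre (d * logCard K) N Z < ((N : ℝ≥0∞) + 1)⁻¹ := by
      rw [ENNReal.iSup_eq_zero.1 h N]
      exact ENNReal.inv_pos.2 (by simp)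
    simpa only [bowenPre, iInf_lt_iff, exists_prop] using h0
  choose 𝒲 hlen hcov hsum using hpre
  have key := Measure.hausdorffMeasure_le_liminf_tsum (d : ℝ) Z (l := atTop)
    (fun n => ENNReal.ofReal (((K : ℝ)⁻¹) ^ n)) (tendsto_ofReal_inv_card_pow hK)
    (fun N (W : 𝒲 N) => cylinder (W : List (Fin K)))
    (Eventually.of_forall fun N W => (ediam_cylinder_le _).trans <| ENNReal.ofReal_le_ofReal <|
      pow_le_pow_of_le_one (inv_card_pos hK).le (inv_card_lt_one hK).le (hlen N W W.2).le)
    (Eventually.of_forall fun N => by rw [iUnion_coe_set]; exact hcov N)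
  refine le_antisymm (key.trans ?_) zero_le
  have hlim : Tendsto (fun N : ℕ => ((N : ℝ≥0∞) + 1)⁻¹) atTop (𝓝 0) := by
    simpa using (tendsto_add_atTop_iff_nat 1).2 ENNReal.tendsto_inv_nat_nhds_zero
  rw [← hlim.liminf_eq]
  refine liminf_le_liminf (Eventually.of_forall fun N => le_trans ?_ (hsum N).le)
  refine ENNReal.tsum_le_tsum fun W => ?_
  rw [weight_eq hK]
  exact ENNReal.rpow_le_rpow (ediam_cylinder_le _) d.2

/-- A set of diameter less than `η ≤ K ^ (-N)` lies in a cylinder of length larger than `N` and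
diameter at most `η`. -/
theorem exists_cylinder_of_ediam_lt (hK : 2 ≤ K) {T : Set (FullShift K)} (hT : T.Nonempty)
    {η : ℝ≥0∞} (hη : Metric.ediam T < η) {N : ℕ} (hN : η ≤ ENNReal.ofReal (((K : ℝ)⁻¹) ^ N)) :
    ∃ W : List (Fin K), N < W.length ∧ T ⊆ cylinder W ∧
      ENNReal.ofReal (((K : ℝ)⁻¹) ^ W.length) ≤ η := by
  obtain ⟨x, hx⟩ := hT
  lift η to ℝ≥0 using ne_top_of_le_ne_top ENNReal.ofReal_ne_top hN
  have hη0 : (0 : ℝ) < η := by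
    have : (0 : ℝ≥0∞) < η := zero_le.trans_lt hη
    exact_mod_cast this
  have hpow : ∀ n : ℕ, (0 : ℝ) ≤ ((K : ℝ)⁻¹) ^ n := fun n => (pow_pos (inv_card_pos hK) n).le
  have hηN : (η : ℝ) ≤ ((K : ℝ)⁻¹) ^ N := by
    rwa [← ENNReal.ofReal_coe_nnreal, ENNReal.ofReal_le_ofReal_iff (hpow N)] at hN
  obtain ⟨m, hm1, hm2⟩ := exists_nat_pow_near_of_lt_one hη0
    (hηN.trans (pow_le_one₀ (inv_card_pos hK).le (inv_card_lt_one hK).le)) (inv_card_pos hK)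
    (inv_card_lt_one hK)
  refine ⟨prefixWord (m + 1) x, ?_, fun y hy => mem_cylinder_prefixWord.2 ?_, ?_⟩
  · rw [length_prefixWord]
    exact (pow_lt_pow_iff_right_of_lt_one₀ (inv_card_pos hK) (inv_card_lt_one hK)).1
      (hm1.trans_le hηN)
  · have hd : dist y x < ((K : ℝ)⁻¹) ^ m := by
      have := (Metric.edist_le_ediam_of_mem hy hx).trans_lt hη
      rw [edist_dist, ← ENNReal.ofReal_coe_nnreal, ENNReal.ofReal_lt_ofReal_iff hη0] at this
      exact this.trans_le hm2
    by_cases hxy : y = x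
    · simp [hxy]
    rw [dist_of_ne hxy] at hd
    have := (pow_lt_pow_iff_right_of_lt_one₀ (inv_card_pos hK) (inv_card_lt_one hK)).1 hd
    exact fun i hi => PiNat.apply_eq_of_lt_firstDiff (by lia)
  · rw [length_prefixWord, ← ENNReal.ofReal_coe_nnreal]
    exact ENNReal.ofReal_le_ofReal hm1.le

/-- Each set of a Hausdorff cover is replaced by a cylinder of hardly larger diameter; sets of
diameter `0` need an arbitrarily small extra weight, whence `0 < d`. -/
theorem bowenMeasure_eq_zero_of_hausdorffMeasure [MeasurableSpace (FullShift K)]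
    [BorelSpace (FullShift K)] (hK : 2 ≤ K) {d : ℝ≥0} (hd : 0 < d) {Z : Set (FullShift K)}
    (h : μH[d] Z = 0) : bowenMeasure (d * logCard K) Z = 0 := by
  have hd' : (0 : ℝ) < d := hd
  refine ENNReal.iSup_eq_zero.2 fun N => le_antisymm ?_ zero_le
  refine le_of_forall_gt_imp_ge_of_dense fun ε hε => ?_
  have hρ : (0 : ℝ≥0∞) < ENNReal.ofReal (((K : ℝ)⁻¹) ^ (N + 1)) :=
    ENNReal.ofReal_pos.2 (pow_pos (inv_card_pos hK) _)
  have hρN : ENNReal.ofReal (((K : ℝ)⁻¹) ^ (N + 1)) < ENNReal.ofReal (((K : ℝ)⁻¹) ^ N) :=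
    (ENNReal.ofReal_lt_ofReal_iff (pow_pos (inv_card_pos hK) _)).2
      (pow_lt_pow_right_of_lt_one₀ (inv_card_pos hK) (inv_card_lt_one hK) (Nat.lt_succ_self N))
  obtain ⟨e, he, hesum⟩ := ENNReal.exists_pos_sum_of_countable (ι := ℕ)
    (ENNReal.half_pos hε.ne').ne'
  obtain ⟨T, hcov, hdiam, hsum⟩ : ∃ T : ℕ → Set (FullShift K), Z ⊆ (⋃ n, T n) ∧
      (∀ n, Metric.ediam (T n) ≤ ENNReal.ofReal (((K : ℝ)⁻¹) ^ (N + 1))) ∧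
      ∑' n, ⨆ _ : (T n).Nonempty, Metric.ediam (T n) ^ (d : ℝ) < ε / 2 := by
    rw [Measure.hausdorffMeasure_apply] at h
    have h1 := le_antisymm ((le_iSup₂ (f := fun (r : ℝ≥0∞) (_ : 0 < r) =>
      ⨅ (t : ℕ → Set (FullShift K)) (_ : Z ⊆ ⋃ n, t n) (_ : ∀ n, Metric.ediam (t n) ≤ r),
          ∑' n, ⨆ _ : (t n).Nonempty, Metric.ediam (t n) ^ (d : ℝ)) _ hρ).trans_eq h) zero_le
    have h2 := h1.trans_lt (ENNReal.half_pos hε.ne')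
    simpa only [iInf_lt_iff, exists_prop] using h2
  have hW : ∀ n : {n // (T n).Nonempty}, ∃ W : List (Fin K), N < W.length ∧ T n ⊆ cylinder W ∧
      weight (d * logCard K) W ≤ Metric.ediam (T n) ^ (d : ℝ) + e n := by
    rintro ⟨n, hn⟩
    -- the scale `η` exceeds the diameter, and its power `η ^ d` costs at most `e n` more
    have h1 : Metric.ediam (T n) < (Metric.ediam (T n) ^ (d : ℝ) + e n) ^ (d : ℝ)⁻¹ := by
      rw [ENNReal.lt_rpow_inv_iff hd']
      exact ENNReal.lt_add_right
        (ENNReal.rpow_ne_top_of_nonneg d.2 (ne_top_of_le_ne_top (by finiteness) (hdiam n)))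
        (by exact_mod_cast (he n).ne')
    obtain ⟨W, hW1, hW2, hW3⟩ := exists_cylinder_of_ediam_lt hK hn
      (lt_min h1 ((hdiam n).trans_lt hρN)) (min_le_right _ _)
    refine ⟨W, hW1, hW2, ?_⟩
    rw [weight_eq hK, ← ENNReal.le_rpow_inv_iff hd']
    exact hW3.trans (min_le_left _ _)
  choose W hlen hsub hwt using hW
  calc bowenPre (d * logCard K) N Z
      ≤ ∑' V : range W, weight (d * logCard K) (V : List (Fin K)) := by
        refine iInf_le_of_le (range W) (iInf_le_of_le ?_ (iInf_le_of_le ?_ le_rfl))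
        · rintro _ ⟨n, rfl⟩; exact hlen n
        · intro x hx
          obtain ⟨n, hn⟩ := mem_iUnion.1 (hcov hx)
          exact mem_iUnion₂.2 ⟨_, ⟨⟨n, ⟨x, hn⟩⟩, rfl⟩, hsub _ hn⟩
    _ ≤ ∑' n : {n // (T n).Nonempty}, weight (d * logCard K) (W n) :=
        ENNReal.tsum_le_tsum_comp_of_surjective rangeFactorization_surjective
          (fun V : range W => weight (d * logCard K) (V : List (Fin K)))
    _ ≤ ∑' n : {n // (T n).Nonempty},
          ((⨆ _ : (T n).Nonempty, Metric.ediam (T n) ^ (d : ℝ)) + e n) :=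
        ENNReal.tsum_le_tsum fun n => by rw [iSup_pos n.2]; exact hwt n
    _ ≤ ∑' n : ℕ, ((⨆ _ : (T n).Nonempty, Metric.ediam (T n) ^ (d : ℝ)) + e n) :=
        ENNReal.tsum_comp_le_tsum_of_injective Subtype.val_injective _
    _ ≤ ε / 2 + ε / 2 := by
        rw [ENNReal.tsum_add]
        exact add_le_add hsum.le hesum.le
    _ = ε := ENNReal.add_halves ε

theorem dimH_mul_logCard (hK : 2 ≤ K) (Z : Set (FullShift K)) :
    dimH Z * logCard K = bowenEntropy Z := by
  borelize (FullShift K)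
  have hl := logCard_pos hK
  have hl0 : (logCard K : ℝ≥0∞) ≠ 0 := by exact_mod_cast hl.ne'
  apply le_antisymm
  · refine le_iInf₂ fun s hs => ?_
    rw [← ENNReal.le_div_iff_mul_le (Or.inl hl0) (Or.inl ENNReal.coe_ne_top),
      ← ENNReal.coe_div hl.ne']
    refine dimH_le_of_hausdorffMeasure_ne_top ?_
    rw [hausdorffMeasure_eq_zero_of_bowenMeasure hK (d := s / logCard K)]
    · exact ENNReal.zero_ne_top
    · rwa [div_mul_cancel₀ _ hl.ne']
  · rw [← ENNReal.div_le_iff hl0 ENNReal.coe_ne_top]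
    refine le_of_forall_gt_imp_ge_of_dense fun d hd => ?_
    induction d with
    | top => exact le_top
    | coe d =>
      rw [ENNReal.div_le_iff hl0 ENNReal.coe_ne_top, ← ENNReal.coe_mul]
      have hd0 : (0 : ℝ≥0∞) < d := zero_le.trans_lt hd
      exact iInf₂_le_of_le (d * logCard K) (bowenMeasure_eq_zero_of_hausdorffMeasure hK
        (by exact_mod_cast hd0) (hausdorffMeasure_of_dimH_lt hd)) le_rfl

/-- The constant comes from the factor `2` in the diameter of a ball and from the factor `K` between
the radius of a ball and that of the largest cylinder it contains around its centre. -/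
theorem ballPackingLim_le (hK : 2 ≤ K) (d : ℝ≥0) (E : Set (FullShift K)) :
    ballPackingLim d E ≤ (2 * K : ℝ≥0∞) ^ (d : ℝ) * packingLim (d * logCard K) E := by
  have hC : (2 * K : ℝ≥0∞) ^ (d : ℝ) ≠ ⊤ := ENNReal.rpow_ne_top_of_nonneg d.2 (by finiteness)
  have hC0 : (2 * K : ℝ≥0∞) ^ (d : ℝ) ≠ 0 := by
    have : K ≠ 0 := by lia
    simp [this]
  have hK0 : (K : ℝ≥0) ≠ 0 := by exact_mod_cast (by lia : K ≠ 0)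
  rw [packingLim, ENNReal.mul_iInf_of_ne hC0 hC]
  refine le_iInf fun N => iInf₂_le_of_le ((K : ℝ≥0)⁻¹ ^ N) (by positivity) ?_
  refine iSup_le fun ℬ => iSup_le fun hℬ => iSup_le fun hdisj => ?_
  have hn : ∀ b : ℬ, ∃ n : ℕ, N ≤ n ∧ ((K : ℝ)⁻¹) ^ n ≤ b.1.2 ∧
      (b.1.2 : ℝ) ≤ K * ((K : ℝ)⁻¹) ^ n := by
    intro b
    obtain ⟨-, h0, h1⟩ := hℬ b b.2
    have h0' : (0 : ℝ) < b.1.2 := h0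
    have h1' : (b.1.2 : ℝ) ≤ ((K : ℝ)⁻¹) ^ N := by exact_mod_cast h1
    obtain ⟨m, hm1, hm2⟩ := exists_nat_pow_near_of_lt_one h0'
      (h1'.trans (pow_le_one₀ (inv_card_pos hK).le (inv_card_lt_one hK).le)) (inv_card_pos hK)
      (inv_card_lt_one hK)
    refine ⟨m + 1, ?_, hm1.le, ?_⟩
    · exact ((pow_lt_pow_iff_right_of_lt_one₀ (inv_card_pos hK) (inv_card_lt_one hK)).1
        (hm1.trans_le h1')).le
    · have : (K : ℝ) ≠ 0 := by exact_mod_cast hK0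
      rwa [pow_succ', mul_inv_cancel_left₀ this]
  choose n hnN hn1 hn2 using hn
  let w : ℬ → List (Fin K) := fun b => prefixWord (n b) b.1.1
  have hsub : ∀ b : ℬ, cylinder (w b) ⊆ Metric.closedBall b.1.1 (b.1.2 : ℝ) := fun b => by
    rw [← closedBall_pow hK]
    exact Metric.closedBall_subset_closedBall (hn1 b)
  have hwd : ∀ b c : ℬ, b ≠ c → Disjoint (cylinder (w b)) (cylinder (w c)) := fun b c hbc =>
    (hdisj b.2 c.2 fun h => hbc (Subtype.ext h)).mono (hsub b) (hsub c)
  have hinj : Function.Injective w := fun b c hbc => by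
    by_contra hne
    have := hwd b c hne
    rw [← hbc, disjoint_self] at this
    exact (this.subset (self_mem_cylinder_prefixWord (n b) b.1.1)).elim
  have hle : ∑' V : range w, weight (d * logCard K) (V : List (Fin K)) ≤
      packingPre (d * logCard K) N E := by
    refine le_iSup_of_le (range w) (le_iSup_of_le ?_ (le_iSup_of_le ?_ le_rfl))
    · rintro _ ⟨b, rfl⟩
      refine ⟨by simpa [w] using hnN b, b.1.1, self_mem_cylinder_prefixWord _ _, (hℬ b b.2).1⟩
    · rintro _ ⟨b, rfl⟩ _ ⟨c, rfl⟩ hbc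
      exact hwd b c fun h => hbc (by rw [h])
  rw [tsum_range (weight (d * logCard K)) hinj] at hle
  refine le_trans ?_ (mul_le_mul_right hle _)
  rw [← ENNReal.tsum_mul_left]
  refine ENNReal.tsum_le_tsum fun b => ?_
  rw [weight_eq hK, ← ENNReal.mul_rpow_of_nonneg _ _ d.coe_nonneg]
  refine ENNReal.rpow_le_rpow ?_ d.2
  rw [length_prefixWord, ENNReal.coe_mul, mul_assoc, ENNReal.coe_ofNat]
  gcongr
  rw [← ENNReal.ofReal_coe_nnreal, ← ENNReal.ofReal_natCast, ← ENNReal.ofReal_mul (by positivity)]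
  exact ENNReal.ofReal_le_ofReal (hn2 b)

/-- No constant is needed: each cylinder is itself a closed ball centred at any of its points. -/
theorem packingLim_le (hK : 2 ≤ K) (d : ℝ≥0) (E : Set (FullShift K)) :
    packingLim (d * logCard K) E ≤ ballPackingLim d E := by
  refine le_iInf₂ fun δ hδ => ?_
  obtain ⟨N, hN⟩ := exists_pow_lt_of_lt_one (show (0 : ℝ) < δ from hδ) (inv_card_lt_one hK)
  refine iInf_le_of_le N ?_
  refine iSup_le fun 𝒲 => iSup_le fun h𝒲 => iSup_le fun hdisj => ?_
  choose x hxW hxE using fun W : 𝒲 => (h𝒲 W W.2).2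
  let b : 𝒲 → FullShift K × ℝ≥0 := fun W => (x W, (K : ℝ≥0)⁻¹ ^ (W : List (Fin K)).length)
  have hball : ∀ W : 𝒲, Metric.closedBall (b W).1 ((b W).2 : ℝ) = cylinder (W : List (Fin K)) := by
    intro W
    have := closedBall_pow hK (x W) (W : List (Fin K)).length
    rw [mem_cylinder_iff.1 (hxW W)] at this
    simpa [b] using this
  have hinj : Function.Injective b := fun V W hVW => by
    by_contra hne
    have := hdisj V.2 W.2 fun h => hne (Subtype.ext h)
    rw [Function.onFun, ← hball V, ← hball W, hVW, disjoint_self, hball] at this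
    exact (this.subset (hxW W)).elim
  refine le_trans ?_ (le_iSup_of_le (range b) (le_iSup_of_le ?_ (le_iSup_of_le ?_ le_rfl)))
  · rw [tsum_range (fun c : FullShift K × ℝ≥0 => ((2 * c.2 : ℝ≥0) : ℝ≥0∞) ^ (d : ℝ)) hinj]
    refine ENNReal.tsum_le_tsum fun W => ?_
    rw [weight_eq hK]
    refine ENNReal.rpow_le_rpow ?_ d.2
    have h1 : ((K : ℝ)⁻¹) ^ (W : List (Fin K)).length = ((b W).2 : ℝ) := by simp [b]
    rw [h1, ENNReal.ofReal_coe_nnreal]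
    exact_mod_cast le_mul_of_one_le_left (zero_le) one_le_two
  · rintro _ ⟨W, rfl⟩
    have hK0 : (0 : ℝ≥0) < K := by exact_mod_cast (by lia : 0 < K)
    refine ⟨hxE W, by positivity, ?_⟩
    have h1 : ((K : ℝ)⁻¹) ^ (W : List (Fin K)).length ≤ δ :=
      (pow_le_pow_of_le_one (inv_card_pos hK).le (inv_card_lt_one hK).le (h𝒲 W W.2).1).trans hN.le
    exact_mod_cast h1
  · rintro _ ⟨V, rfl⟩ _ ⟨W, rfl⟩ hVW
    rw [Function.onFun, hball, hball]
    exact hdisj V.2 W.2 fun h => hVW (by rw [Subtype.ext h])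

theorem ballPackingMeasure_eq_zero_iff (hK : 2 ≤ K) (d : ℝ≥0) (E : Set (FullShift K)) :
    ballPackingMeasure d E = 0 ↔ packingMeasure (d * logCard K) E = 0 := by
  have hC : (2 * K : ℝ≥0∞) ^ (d : ℝ) ≠ ⊤ := ENNReal.rpow_ne_top_of_nonneg d.2 (by finiteness)
  have hC0 : (2 * K : ℝ≥0∞) ^ (d : ℝ) ≠ 0 := by
    have : K ≠ 0 := by lia
    simp [this]
  constructor <;> intro h <;> refine le_antisymm ?_ zero_le
  · rw [← h]
    exact le_iInf₂ fun Y hY => iInf₂_le_of_le Y hY (ENNReal.tsum_le_tsum fun i =>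
      packingLim_le hK d (Y i))
  · calc ballPackingMeasure d E ≤ (2 * K : ℝ≥0∞) ^ (d : ℝ) * packingMeasure (d * logCard K) E := by
          simp only [packingMeasure, ENNReal.mul_iInf_of_ne hC0 hC]
          refine le_iInf₂ fun Y hY => iInf₂_le_of_le Y hY ?_
          rw [← ENNReal.tsum_mul_left]
          exact ENNReal.tsum_le_tsum fun i => ballPackingLim_le hK d (Y i)
      _ ≤ 0 := by rw [h, mul_zero]

theorem dimP_mul_logCard (hK : 2 ≤ K) (Z : Set (FullShift K)) :
    dimP Z * logCard K = packingEntropy Z := by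
  have hl := logCard_pos hK
  have hl0 : (logCard K : ℝ≥0∞) ≠ 0 := by exact_mod_cast hl.ne'
  apply le_antisymm
  · refine le_iInf₂ fun s hs => ?_
    rw [← ENNReal.le_div_iff_mul_le (Or.inl hl0) (Or.inl ENNReal.coe_ne_top),
      ← ENNReal.coe_div hl.ne']
    refine iInf₂_le_of_le (s / logCard K) ((ballPackingMeasure_eq_zero_iff hK _ _).2 ?_) le_rfl
    rwa [div_mul_cancel₀ _ hl.ne']
  · rw [← ENNReal.div_le_iff hl0 ENNReal.coe_ne_top]
    refine le_iInf₂ fun d hd => ?_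
    rw [ENNReal.div_le_iff hl0 ENNReal.coe_ne_top, ← ENNReal.coe_mul]
    exact iInf₂_le_of_le (d * logCard K) ((ballPackingMeasure_eq_zero_iff hK _ _).1 hd) le_rfl

theorem prefixWord_add (m n : ℕ) (x : FullShift K) :
    prefixWord (m + n) x = prefixWord m x ++ prefixWord n (shift^[m] x) := by
  rw [prefixWord, List.ofFn_add]
  congr 1
  refine congrArg List.ofFn (funext fun i => ?_)
  rw [shift_iterate_apply]
  rfl

/-! ### Topological entropy and the growth of the language -/

theorem ncard_language_le_coverMincard (Z : Set (FullShift K)) (n : ℕ) :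
    ((language n Z).ncard : ℕ∞) ≤
      Dynamics.coverMincard (shift : FullShift K → FullShift K) Z {p | dist p.1 p.2 < 1} n := by
  refine le_iInf₂ fun s hs => ?_
  have hsub : language n Z ⊆ prefixWord n '' (s : Set (FullShift K)) := by
    rintro _ ⟨z, hz, rfl⟩
    obtain ⟨y, hy, hzy⟩ := hs hz
    refine ⟨y, hy, prefixWord_eq_iff.2 fun i hi => ?_⟩
    have hd : dist (shift^[i] z) (shift^[i] y) < 1 := Dynamics.mem_dynEntourage.1 hzy i hi
    by_contra hne
    refine hd.ne (dist_eq_one_of_ne ?_)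
    rw [shift_iterate_apply, shift_iterate_apply, add_zero]
    exact fun h => hne h.symm
  have h1 := (ncard_le_ncard hsub (s.finite_toSet.image _)).trans (ncard_image_le s.finite_toSet)
  rw [ncard_coe_finset] at h1
  exact_mod_cast h1

theorem coverMincard_le_ncard_language (Z : Set (FullShift K))
    {U : SetRel (FullShift K) (FullShift K)}
    {k : ℕ} (hU : ∀ x y : FullShift K, (∀ i < k, x i = y i) → (x, y) ∈ U) (n : ℕ) :
    Dynamics.coverMincard (shift : FullShift K → FullShift K) Z U n ≤
      ((language (n + k) Z).ncard : ℕ∞) := by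
  classical
  have hfin := finite_language (n + k) Z
  choose z hz hzW using fun W (hW : W ∈ language (n + k) Z) => hW
  have hcov : Dynamics.IsDynCoverOf (shift : FullShift K → FullShift K) Z U n
      (hfin.toFinset.attach.image fun W => z W.1 (hfin.mem_toFinset.1 W.2) : Finset (FullShift K)) := by
    intro x hx
    have hxL : prefixWord (n + k) x ∈ language (n + k) Z := ⟨x, hx, rfl⟩
    refine ⟨z _ hxL, ?_, ?_⟩
    · rw [Finset.mem_coe]
      exact Finset.mem_image.2 ⟨⟨_, hfin.mem_toFinset.2 hxL⟩, Finset.mem_attach _ _, rfl⟩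
    · refine Dynamics.mem_dynEntourage.2 fun j hj => hU _ _ fun i hi => ?_
      rw [shift_iterate_apply, shift_iterate_apply]
      exact (prefixWord_eq_iff.1 (hzW _ hxL) (j + i) (by lia)).symm
  refine hcov.coverMincard_le_card.trans ?_
  rw [ncard_eq_toFinset_card _ hfin]
  exact_mod_cast Finset.card_image_le.trans_eq Finset.card_attach

/-- If the entropy of `Z` is less than `s`, then `Z` has at most `exp (s n)` words of each large
length `n`. -/
theorem eventually_ncard_language_le {Z : Set (FullShift K)} {s : ℝ} (h : topEntropy Z < s) :
    ∀ᶠ n in atTop, ((language n Z).ncard : ℝ) ≤ Real.exp (s * n) := by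
  have h1 : Dynamics.coverEntropyEntourage (shift : FullShift K → FullShift K) Z
      {p | dist p.1 p.2 < 1} < s :=
    (le_iSup₂ (f := fun U (_ : U ∈ uniformity (FullShift K)) =>
      Dynamics.coverEntropyEntourage (shift : FullShift K → FullShift K) Z U) _
        (Metric.dist_mem_uniformity one_pos)).trans_lt h
  filter_upwards [ExpGrowth.eventually_le_exp h1] with n hn
  have h2 := (ENat.toENNReal_mono (ncard_language_le_coverMincard Z n)).trans hn
  have h3 : ((s : EReal) * (n : EReal)) = ((s * n : ℝ) : EReal) := by simp
  rw [h3, EReal.exp_coe, ENat.toENNReal_coe, ← ENNReal.ofReal_natCast,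
    ENNReal.ofReal_le_ofReal_iff (Real.exp_pos _).le] at h2
  exact h2

/-- If `Z` has at most `C exp (s n)` words of each large length `n`, then the entropy of `Z` is at
most `s`. -/
theorem topEntropy_le (hK : 2 ≤ K) {Z : Set (FullShift K)} {s C : ℝ}
    (h : ∀ᶠ n in atTop, ((language n Z).ncard : ℝ) ≤ C * Real.exp (s * n)) :
    topEntropy Z ≤ s := by
  refine EReal.le_of_forall_lt_iff_le.1 fun b hb => iSup₂_le fun U hU => ?_
  have hsb : s < b := by exact_mod_cast hb
  obtain ⟨ε, hε, hεU⟩ := Metric.mem_uniformity_dist.1 hU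
  obtain ⟨k, hk⟩ := exists_pow_lt_of_lt_one hε (inv_card_lt_one hK)
  have hkU : ∀ x y : FullShift K, (∀ i < k, x i = y i) → (x, y) ∈ U := fun x y hxy =>
    hεU ((dist_le_of_agree hxy).trans_lt hk)
  refine _root_.Eventually.expGrowthSup_le ?_
  have hlim : Tendsto (fun n : ℕ => Real.exp ((b - s) * n)) atTop atTop :=
    Real.tendsto_exp_atTop.comp
      (tendsto_natCast_atTop_atTop.const_mul_atTop (sub_pos.2 hsb))
  filter_upwards [(tendsto_add_atTop_iff_nat k).2 tendsto_id |>.eventually h,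
    hlim.eventually_ge_atTop (C * Real.exp (s * k))] with n hn1 hn2
  have h3 : ((b : EReal) * (n : EReal)) = ((b * n : ℝ) : EReal) := by simp
  refine (ENat.toENNReal_mono (coverMincard_le_ncard_language Z hkU n)).trans ?_
  rw [h3, EReal.exp_coe, ENat.toENNReal_coe, ← ENNReal.ofReal_natCast]
  refine ENNReal.ofReal_le_ofReal ?_
  calc ((language (n + k) Z).ncard : ℝ) ≤ C * Real.exp (s * (n + k : ℕ)) := hn1
    _ = (C * Real.exp (s * k)) * Real.exp (s * n) := by
        rw [mul_assoc, ← Real.exp_add]; push_cast; ring_nf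
    _ ≤ Real.exp ((b - s) * n) * Real.exp (s * n) := by gcongr
    _ = Real.exp (b * n) := by rw [← Real.exp_add]; ring_nf

/-! ### Upper bounds from counting words -/

theorem tsum_weight_ne_top {S : ℕ → Set (List (Fin K))} (hS : ∀ n, ∀ W ∈ S n, W.length = n)
    {s : ℝ≥0} {s' C : ℝ} (hs : s' < s)
    (h : ∀ᶠ n in atTop, ((S n).ncard : ℝ) ≤ C * Real.exp (s' * n)) :
    ∑' n, ∑' W : S n, weight s (W : List (Fin K)) ≠ ⊤ := by
  simp_rw [fun n => tsum_weight_of_length (hS n) s, ← ENNReal.ofReal_natCast,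
    ← ENNReal.ofReal_mul (Nat.cast_nonneg _)]
  refine Summable.tsum_ofReal_ne_top ?_
  have hr : Real.exp (s' - s) < 1 := Real.exp_lt_one_iff.2 (sub_neg.2 hs)
  refine Summable.of_norm_bounded_eventually_nat (g := fun n => C * Real.exp (s' - s) ^ n)
    ((summable_geometric_of_lt_one (Real.exp_pos _).le hr).mul_left C) ?_
  filter_upwards [h] with n hn
  rw [Real.norm_of_nonneg (by positivity), ← Real.exp_nat_mul]
  calc ((S n).ncard : ℝ) * Real.exp (-(s * n))
      ≤ (C * Real.exp (s' * n)) * Real.exp (-(s * n)) := by gcongr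
    _ = C * Real.exp (n * (s' - s)) := by rw [mul_assoc, ← Real.exp_add]; ring_nf

/-- Borel–Cantelli argument for Bowen's measure: `ℋ^s` vanishes on the points that have infinitely
many prefixes in a family of words with finite total weight. -/
theorem bowenMeasure_eq_zero {S : ℕ → Set (List (Fin K))} (hS : ∀ n, ∀ W ∈ S n, W.length = n)
    {s : ℝ≥0} {Z : Set (FullShift K)} (h : ∑' n, ∑' W : S n, weight s (W : List (Fin K)) ≠ ⊤)
    (hZ : ∀ x ∈ Z, ∃ᶠ n in atTop, prefixWord n x ∈ S n) : bowenMeasure s Z = 0 := by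
  refine ENNReal.iSup_eq_zero.2 fun N => le_antisymm ?_ zero_le
  refine ge_of_tendsto (ENNReal.tendsto_sum_nat_add _ h) ?_
  filter_upwards [eventually_gt_atTop N] with M hM
  refine (iInf₂_le_of_le (⋃ k, S (k + M)) (fun W hW => ?_) (iInf_le_of_le ?_ le_rfl)).trans
    (ENNReal.tsum_iUnion_le_tsum (weight s) fun k => S (k + M))
  · obtain ⟨k, hk⟩ := mem_iUnion.1 hW
    rw [hS _ W hk]
    lia
  · intro x hx
    obtain ⟨n, hn, hxn⟩ := frequently_atTop.1 (hZ x hx) M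
    refine mem_iUnion₂.2 ⟨prefixWord n x, mem_iUnion.2 ⟨n - M, ?_⟩,
      self_mem_cylinder_prefixWord n x⟩
    rwa [Nat.sub_add_cancel hn]

theorem packingLim_eq_zero {s : ℝ≥0} {Z : Set (FullShift K)}
    (h : ∑' n, ∑' W : language n Z, weight s (W : List (Fin K)) ≠ ⊤) : packingLim s Z = 0 := by
  refine le_antisymm (ge_of_tendsto (ENNReal.tendsto_sum_nat_add _ h) ?_) zero_le
  refine Eventually.of_forall fun M => iInf_le_of_le M ?_
  refine iSup_le fun 𝒲 => iSup_le fun h𝒲 => iSup_le fun _ => ?_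
  refine (ENNReal.tsum_mono_subtype (weight s) fun W hW => ?_).trans
    (ENNReal.tsum_iUnion_le_tsum (weight s) fun k => language (k + M) Z)
  obtain ⟨h1, h2⟩ := h𝒲 W hW
  refine mem_iUnion.2 ⟨W.length - M, ?_⟩
  rw [Nat.sub_add_cancel h1]
  exact mem_language_of_cylinder_inter h2

theorem packingMeasure_le_packingLim (s : ℝ≥0) (Z : Set (FullShift K)) :
    packingMeasure s Z ≤ packingLim s Z := by
  refine iInf₂_le_of_le (fun i => if i = 0 then Z else ∅) (fun x hx => mem_iUnion.2 ⟨0, by simpa⟩)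
    ?_
  rw [tsum_eq_single 0]
  · simp
  · intro i hi
    simp only [if_neg hi]
    refine packingLim_eq_zero ?_
    simp [language]

theorem packingMeasure_mono (s : ℝ≥0) {Y Z : Set (FullShift K)} (h : Y ⊆ Z) :
    packingMeasure s Y ≤ packingMeasure s Z :=
  le_iInf₂ fun T hT => iInf₂_le_of_le T (h.trans hT) le_rfl

theorem tsum_weight_language_ne_top {Z : Set (FullShift K)} {s : ℝ≥0}
    (h : topEntropy Z < ((s : ℝ) : EReal)) :
    ∑' n, ∑' W : language n Z, weight s (W : List (Fin K)) ≠ ⊤ := by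
  obtain ⟨s', h1, h2⟩ := EReal.lt_iff_exists_real_btwn.1 h
  refine tsum_weight_ne_top (fun n W hW => length_of_mem_language hW) (s' := s') (C := 1)
    (by exact_mod_cast h2) ?_
  simpa using eventually_ncard_language_le h1

theorem bowenEntropy_le_topEntropy {Z : Set (FullShift K)} (h0 : 0 ≤ topEntropy Z) :
    (bowenEntropy Z : EReal) ≤ topEntropy Z := by
  refine EReal.le_of_forall_lt_iff_le.1 fun s hs => ?_
  have hs0 : 0 ≤ s := by exact_mod_cast (h0.trans_lt hs).le
  lift s to ℝ≥0 using hs0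
  have := bowenMeasure_eq_zero (fun n W hW => length_of_mem_language hW)
    (tsum_weight_language_ne_top hs) fun x hx => Frequently.of_forall fun n => ⟨x, hx, rfl⟩
  rw [← EReal.coe_nnreal_eq_coe_real, EReal.coe_ennreal_le_coe_ennreal_iff]
  exact iInf₂_le_of_le s this le_rfl

theorem packingEntropy_le_topEntropy {Y Z : Set (FullShift K)} (hYZ : Y ⊆ Z)
    (h0 : 0 ≤ topEntropy Z) : (packingEntropy Y : EReal) ≤ topEntropy Z := by
  refine EReal.le_of_forall_lt_iff_le.1 fun s hs => ?_
  have hs0 : 0 ≤ s := by exact_mod_cast (h0.trans_lt hs).le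
  lift s to ℝ≥0 using hs0
  have : packingMeasure s Y = 0 := le_antisymm
    ((packingMeasure_mono s hYZ).trans ((packingMeasure_le_packingLim s Z).trans_eq
      (packingLim_eq_zero (tsum_weight_language_ne_top hs)))) zero_le
  rw [← EReal.coe_nnreal_eq_coe_real, EReal.coe_ennreal_le_coe_ennreal_iff]
  exact iInf₂_le_of_le s this le_rfl

/-! ### Bowen entropy of a compact invariant set -/

/-- A cover of a compact invariant set by cylinders of total weight at most one bounds the growth
of its language: every long word starts with a word of the cover, and what remains is again a word
of the language, so the numbers of words satisfy a linear recursion. -/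
theorem topEntropy_le_of_bowenMeasure (hK : 2 ≤ K) {Z : Set (FullShift K)} (hc : IsCompact Z)
    (hinv : ∀ x ∈ Z, ∀ k, shift^[k] x ∈ Z) {s : ℝ≥0} (h : bowenMeasure s Z = 0) :
    topEntropy Z ≤ ((s : ℝ) : EReal) := by
  obtain ⟨𝒲, hlen, hcov, hsum⟩ : ∃ 𝒲 : Set (List (Fin K)), (∀ W ∈ 𝒲, 0 < W.length) ∧
      (Z ⊆ ⋃ W ∈ 𝒲, cylinder W) ∧ ∑' W : 𝒲, weight s (W : List (Fin K)) < 1 := by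
    have h0 : bowenPre s 0 Z < 1 := by
      rw [ENNReal.iSup_eq_zero.1 h 0]
      exact one_pos
    simpa only [bowenPre, iInf_lt_iff, exists_prop] using h0
  obtain ⟨F, hF, hfin, hFcov⟩ := hc.elim_finite_subcover_image
    (fun W _ => isOpen_cylinder hK W) hcov
  lift F to Finset (List (Fin K)) using hfin
  have hFsum : ∑ W ∈ F, Real.exp (-((s : ℝ) * (W.length : ℝ))) ≤ 1 := by
    have h1 : ∑ W ∈ F, weight s W ≤ 1 := by
      rw [← Finset.tsum_subtype]
      exact (ENNReal.tsum_mono_subtype (weight s) hF).trans hsum.le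
    simp only [weight] at h1
    rwa [← ENNReal.ofReal_sum_of_nonneg fun _ _ => (Real.exp_pos _).le, ENNReal.ofReal_le_one]
      at h1
  set L := F.sup List.length with hL
  have hrec : ∀ n, L ≤ n →
      (language n Z).ncard ≤ ∑ W ∈ F, (language (n - W.length) Z).ncard := by
    intro n hn
    have hsub : language n Z ⊆ ⋃ W ∈ F, (fun V => W ++ V) '' language (n - W.length) Z := by
      rintro _ ⟨x, hx, rfl⟩
      obtain ⟨W, hW, hxW⟩ := mem_iUnion₂.1 (hFcov hx)
      have hWn : W.length ≤ n := (Finset.le_sup (f := List.length) hW).trans hn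
      refine mem_iUnion₂.2 ⟨W, hW, prefixWord (n - W.length) (shift^[W.length] x),
        ⟨_, hinv x hx _, rfl⟩, ?_⟩
      conv_rhs => rw [← Nat.add_sub_cancel' hWn, prefixWord_add, mem_cylinder_iff.1 hxW]
    refine (ncard_le_ncard hsub ?_).trans ((F.set_ncard_biUnion_le _).trans ?_)
    · exact F.finite_toSet.biUnion fun W _ => (finite_language _ _).image _
    · exact Finset.sum_le_sum fun W _ => ncard_image_le (finite_language _ _)
  -- `C` bounds the numbers of words of lengths below `L`, where the recursion does not apply
  set C : ℝ := ∑ n ∈ Finset.range L, ((language n Z).ncard : ℝ) with hC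
  have hC0 : 0 ≤ C := Finset.sum_nonneg fun _ _ => Nat.cast_nonneg _
  have hbound : ∀ n, ((language n Z).ncard : ℝ) ≤ C * Real.exp (s * n) := by
    intro n
    induction n using Nat.strong_induction_on with
    | _ n ih =>
      rcases lt_or_ge n L with hn | hn
      · have h1 : ((language n Z).ncard : ℝ) ≤ C :=
          Finset.single_le_sum (f := fun n => ((language n Z).ncard : ℝ))
            (fun _ _ => Nat.cast_nonneg _) (Finset.mem_range.2 hn)
        exact h1.trans (le_mul_of_one_le_right hC0 (Real.one_le_exp (by positivity)))
      · calc ((language n Z).ncard : ℝ)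
            ≤ ∑ W ∈ F, ((language (n - W.length) Z).ncard : ℝ) := by exact_mod_cast hrec n hn
          _ ≤ ∑ W ∈ F, C * Real.exp (s * n) * Real.exp (-((s : ℝ) * (W.length : ℝ))) := by
              refine Finset.sum_le_sum fun W hW => ?_
              have hWn : W.length ≤ n := (Finset.le_sup (f := List.length) hW).trans hn
              refine (ih _ (Nat.sub_lt_self (hlen W (hF hW)) hWn)).trans_eq ?_
              rw [mul_assoc, ← Real.exp_add, Nat.cast_sub hWn]
              ring_nf
          _ ≤ C * Real.exp (s * n) := by
              rw [← Finset.mul_sum]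
              exact mul_le_of_le_one_right (by positivity) hFsum
  exact topEntropy_le hK (Eventually.of_forall hbound)

theorem bowenEntropy_eq_topEntropy (hK : 2 ≤ K) {Z : Set (FullShift K)} (hc : IsCompact Z)
    (hinv : ∀ x ∈ Z, ∀ k, shift^[k] x ∈ Z) (hne : Z.Nonempty) :
    (bowenEntropy Z : EReal) = topEntropy Z := by
  refine le_antisymm (bowenEntropy_le_topEntropy (Dynamics.coverEntropy_nonneg _ hne)) ?_
  refine EReal.le_of_forall_lt_iff_le.1 fun s hs => ?_
  have hs0 : 0 ≤ s := by
    have := (EReal.coe_ennreal_nonneg (bowenEntropy Z)).trans_lt hs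
    exact_mod_cast this.le
  lift s to ℝ≥0 using hs0
  rw [← EReal.coe_nnreal_eq_coe_real, EReal.coe_ennreal_lt_coe_ennreal_iff] at hs
  simp only [bowenEntropy, iInf_lt_iff, exists_prop] at hs
  obtain ⟨t, ht, hts⟩ := hs
  refine (topEntropy_le_of_bowenMeasure hK hc hinv ht).trans ?_
  exact_mod_cast (by exact_mod_cast hts.le : t ≤ s)

/-! ### Bowen entropy of the mean Li–Yorke set -/

/-- The words of length `n` that differ from the prefix of `ω` in at most `δ n` places. -/
def hammingBall (ω : FullShift K) (δ : ℝ) (n : ℕ) : Set (List (Fin K)) :=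
  List.ofFn '' {f : Fin n → Fin K | ((Finset.univ.filter fun i => f i ≠ ω i).card : ℝ) ≤ δ * n}

/-- Each word of the Hamming ball contributes at least `t ^ (δ n)` to the generating sum
`∑ t ^ #{i : f i ≠ ω i} = (1 + (K - 1) t) ^ n` over all words `f` of length `n`. -/
theorem ncard_hammingBall_le (ω : FullShift K) {δ t : ℝ} (ht0 : 0 < t) (ht1 : t ≤ 1) (n : ℕ) :
    ((hammingBall ω δ n).ncard : ℝ) * t ^ (δ * n) ≤ (1 + (K - 1) * t) ^ n := by
  classical
  set B : Finset (Fin n → Fin K) :=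
    Finset.univ.filter fun f => ((Finset.univ.filter fun i => f i ≠ ω i).card : ℝ) ≤ δ * n with hB
  have hcard : (hammingBall ω δ n).ncard ≤ B.card := by
    rw [hammingBall, ← ncard_coe_finset]
    refine (ncard_image_le (toFinite _)).trans_eq (congrArg ncard ?_)
    ext f
    simp [hB]
  have hgen : ∑ f : Fin n → Fin K, ∏ i, (if f i ≠ ω i then t else 1) = (1 + (K - 1) * t) ^ n := by
    have hsum : ∀ a : Fin K, ∑ j : Fin K, (if j ≠ a then t else 1) = 1 + (K - 1) * t := by
      intro a
      rw [← Finset.add_sum_erase _ _ (Finset.mem_univ a), if_neg (not_not.2 rfl),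
        Finset.sum_congr rfl fun j hj => if_pos (Finset.ne_of_mem_erase hj), Finset.sum_const,
        Finset.card_erase_of_mem (Finset.mem_univ a), Finset.card_univ, Fintype.card_fin,
        nsmul_eq_mul, Nat.cast_pred (one_le_card ω)]
    rw [← Fintype.piFinset_univ, ← Finset.prod_univ_sum (fun _ => Finset.univ)
      fun (i : Fin n) j => if j ≠ ω i then t else 1]
    simp_rw [hsum]
    simp
  have hK : (1 : ℝ) ≤ K := by exact_mod_cast one_le_card ω
  calc ((hammingBall ω δ n).ncard : ℝ) * t ^ (δ * n) ≤ B.card * t ^ (δ * n) := by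
        gcongr
    _ = ∑ f ∈ B, t ^ (δ * n) := by rw [Finset.sum_const, nsmul_eq_mul]
    _ ≤ ∑ f ∈ B, ∏ i, (if f i ≠ ω i then t else 1) := by
        refine Finset.sum_le_sum fun f hf => ?_
        rw [Finset.prod_ite, Finset.prod_const, Finset.prod_const_one, mul_one,
          ← Real.rpow_natCast]
        exact Real.rpow_le_rpow_of_exponent_ge ht0 ht1 (Finset.mem_filter.1 hf).2
    _ ≤ ∑ f : Fin n → Fin K, ∏ i, (if f i ≠ ω i then t else 1) := by
        refine Finset.sum_le_sum_of_subset_of_nonneg (Finset.subset_univ _) fun f _ _ => ?_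
        exact Finset.prod_nonneg fun i _ => by split_ifs <;> linarith
    _ = _ := hgen

theorem exists_ncard_hammingBall_le (ω : FullShift K) {s : ℝ} (hs : 0 < s) :
    ∃ δ > 0, ∀ n, ((hammingBall ω δ n).ncard : ℝ) ≤ Real.exp (s * n) := by
  have hK : (1 : ℝ) ≤ K := by exact_mod_cast one_le_card ω
  have hK0 : (0 : ℝ) < K := by linarith
  set t : ℝ := min (1 / 2) (s / (2 * K)) with ht
  have ht0 : 0 < t := lt_min (by norm_num) (by positivity)
  have ht1 : t < 1 := (min_le_left _ _).trans_lt (by norm_num)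
  have htK : K * t ≤ s / 2 := by
    calc K * t ≤ K * (s / (2 * K)) := by gcongr; exact min_le_right _ _
      _ = s / 2 := by field_simp
  have hlog : 0 < -Real.log t := neg_pos.2 (Real.log_neg ht0 ht1)
  -- then `t ^ (δ n) = exp (-(s / 2) n)`, and the generating sum grows by at most `1 + s / 2`
  refine ⟨s / 2 / -Real.log t, by positivity, fun n => ?_⟩
  have h1 := ncard_hammingBall_le ω (δ := s / 2 / -Real.log t) ht0 ht1.le n
  have h2 : t ^ (s / 2 / -Real.log t * n) = Real.exp (-(s / 2 * n)) := by
    rw [Real.rpow_def_of_pos ht0]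
    congr 1
    have := (neg_pos.1 hlog).ne
    field_simp
  have h3 : (1 + (K - 1) * t) ^ n ≤ Real.exp (s / 2 * n) := by
    rw [mul_comm (s / 2), Real.exp_nat_mul]
    have h0 : 0 ≤ (K - 1) * t := mul_nonneg (by linarith) ht0.le
    refine pow_le_pow_left₀ (by linarith) ?_ n
    have := Real.add_one_le_exp (s / 2)
    nlinarith
  rw [h2] at h1
  calc ((hammingBall ω (s / 2 / -Real.log t) n).ncard : ℝ)
      = ((hammingBall ω (s / 2 / -Real.log t) n).ncard : ℝ) * Real.exp (-(s / 2 * n)) *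
          Real.exp (s / 2 * n) := by
        rw [mul_assoc, ← Real.exp_add]; simp
    _ ≤ Real.exp (s / 2 * n) * Real.exp (s / 2 * n) := by
        gcongr
        exact h1.trans h3
    _ = Real.exp (s * n) := by rw [← Real.exp_add]; ring_nf

theorem meanDist_nonneg (x y : FullShift K) (n : ℕ) : 0 ≤ meanDist shift x y n :=
  mul_nonneg (by positivity) (Finset.sum_nonneg fun _ _ => dist_nonneg)

theorem meanDist_le_one (x y : FullShift K) (n : ℕ) : meanDist shift x y n ≤ 1 := by
  rcases Nat.eq_zero_or_pos n with rfl | hn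
  · simp [meanDist]
  have hn' : (0 : ℝ) < n := by exact_mod_cast hn
  rw [meanDist, one_div, inv_mul_le_iff₀ hn', mul_one]
  calc ∑ i ∈ Finset.range n, dist (shift^[i] x) (shift^[i] y)
      ≤ ∑ i ∈ Finset.range n, (1 : ℝ) := Finset.sum_le_sum fun _ _ => dist_le_one _ _
    _ = n := by simp

theorem isBoundedUnder_ge_meanDist (x y : FullShift K) :
    IsBoundedUnder (· ≥ ·) atTop (meanDist shift x y) :=
  isBoundedUnder_of ⟨0, meanDist_nonneg x y⟩

theorem isBoundedUnder_le_meanDist (x y : FullShift K) :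
    IsBoundedUnder (· ≤ ·) atTop (meanDist shift x y) :=
  isBoundedUnder_of ⟨1, meanDist_le_one x y⟩

/-- At each time when `x` and `ω` show different letters, their distance is the maximal one, `1`. -/
theorem card_ne_le_sum_dist (ω x : FullShift K) (n : ℕ) :
    (((Finset.range n).filter fun i => x i ≠ ω i).card : ℝ) ≤
      ∑ i ∈ Finset.range n, dist (shift^[i] ω) (shift^[i] x) := by
  classical
  rw [Finset.card_filter, Nat.cast_sum]
  refine Finset.sum_le_sum fun i _ => ?_
  split_ifs with h
  · rw [dist_eq_one_of_ne, Nat.cast_one]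
    rw [shift_iterate_apply, shift_iterate_apply, add_zero]
    exact h.symm
  · simp

theorem prefixWord_mem_hammingBall {ω x : FullShift K} {δ : ℝ} {n : ℕ}
    (h : meanDist shift ω x n ≤ δ) : prefixWord n x ∈ hammingBall ω δ n := by
  classical
  refine ⟨fun i => x i, ?_, rfl⟩
  have h1 : ((Finset.univ.filter fun i : Fin n => x i ≠ ω i).card : ℝ) =
      ((Finset.range n).filter fun i => x i ≠ ω i).card := by
    rw [Finset.card_filter, Finset.card_filter, Finset.sum_range]
  rw [mem_ofPred_eq, h1]
  refine (card_ne_le_sum_dist ω x n).trans ?_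
  rcases Nat.eq_zero_or_pos n with rfl | hn
  · simp
  have hn' : (0 : ℝ) < n := by exact_mod_cast hn
  rwa [meanDist, one_div, inv_mul_le_iff₀ hn', mul_comm] at h

/-- Already the condition `liminf = 0` forces zero Bowen entropy: infinitely many prefixes of `x`
lie in Hamming balls of small relative radius around the prefixes of `ω`. -/
theorem bowenEntropy_ML (A : Matrix (Fin K) (Fin K) ℕ) (ω : FullShift K) :
    bowenEntropy (ML A ω) = 0 := by
  refine le_antisymm (ENNReal.le_of_forall_pos_le_add fun s hs _ => ?_) zero_le
  rw [zero_add]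
  have hs' : (0 : ℝ) < s := hs
  obtain ⟨δ, hδ, hcount⟩ := exists_ncard_hammingBall_le ω (half_pos hs')
  have hlen : ∀ n, ∀ W ∈ hammingBall ω δ n, W.length = n := by
    rintro n _ ⟨f, -, rfl⟩
    simp
  refine iInf₂_le_of_le s (bowenMeasure_eq_zero hlen
    (tsum_weight_ne_top hlen (half_lt_self hs') (C := 1) (Eventually.of_forall fun n => ?_))
      fun x hx => ?_) le_rfl
  · rw [one_mul]
    exact hcount n
  · have h0 : liminf (meanDist shift ω x) atTop < δ := by rw [hx.2.1]; exact hδ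
    exact (frequently_lt_of_liminf_lt
      (isBoundedUnder_le_meanDist ω x).isCoboundedUnder_ge h0).mono fun n hn =>
        prefixWord_mem_hammingBall hn.le

/-! ### Gluing orbits -/

theorem exists_path_of_pow_pos {A : Matrix (Fin K) (Fin K) ℕ} (hA01 : ∀ i j, A i j = 0 ∨ A i j = 1)
    (n : ℕ) (i j : Fin K) (h : 0 < (A ^ n) i j) :
    ∃ p : ℕ → Fin K, p 0 = i ∧ p n = j ∧ ∀ k < n, A (p k) (p (k + 1)) = 1 := by
  induction n generalizing i with
  | zero =>
    refine ⟨fun _ => i, rfl, ?_, by simp⟩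
    by_contra hij
    simp [hij] at h
  | succ n ih =>
    rw [pow_succ', Matrix.mul_apply] at h
    obtain ⟨l, -, hl⟩ := Finset.exists_ne_zero_of_sum_ne_zero h.ne'
    obtain ⟨p, hp0, hpn, hp⟩ := ih l (Nat.pos_of_ne_zero (right_ne_zero_of_mul hl))
    refine ⟨fun k => Nat.casesOn k i p, rfl, hpn, fun k hk => ?_⟩
    cases k with
    | zero =>
      change A i (p 0) = 1
      rw [hp0]
      exact (hA01 i l).resolve_left (left_ne_zero_of_mul hl)
    | succ k => exact hp k (by lia)

/-- Any two letters are joined by an admissible path of length `r`. -/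
def HasPaths (A : Matrix (Fin K) (Fin K) ℕ) (r : ℕ) : Prop :=
  ∀ i j, ∃ p : ℕ → Fin K, p 0 = i ∧ p r = j ∧ ∀ k < r, A (p k) (p (k + 1)) = 1

/-- The specification property: `x` can be followed up to time `m` and `z` from time `m + r` on. -/
theorem exists_glue {A : Matrix (Fin K) (Fin K) ℕ} {r : ℕ} (hA : HasPaths A r) {x z : FullShift K}
    (hx : x ∈ SFT A) (hz : z ∈ SFT A) (m : ℕ) :
    ∃ y ∈ SFT A, (∀ i ≤ m, y i = x i) ∧ ∀ j, y (m + r + j) = z j := by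
  obtain ⟨p, hp0, hpr, hp⟩ := hA (x m) (z 0)
  let y : FullShift K :=
    ⟨fun i => if i ≤ m then x i else if i < m + r then p (i - m) else z (i - (m + r))⟩
  have h1 : ∀ i ≤ m, y i = x i := fun i hi => if_pos hi
  have h2 : ∀ k ≤ r, y (m + k) = p k := by
    intro k hk
    rcases Nat.eq_zero_or_pos k with rfl | hk0
    · rw [hp0]
      exact h1 m le_rfl
    · change (if m + k ≤ m then _ else if m + k < m + r then p (m + k - m) else
        z (m + k - (m + r))) = p k
      rw [if_neg (by lia)]
      split_ifs with hlt
      · congr 1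
        lia
      · obtain rfl : k = r := by lia
        rw [hpr, Nat.sub_self]
  have h3 : ∀ j, y (m + r + j) = z j := by
    intro j
    rcases Nat.eq_zero_or_pos j with rfl | hj
    · rw [add_zero, h2 r le_rfl, hpr]
    · change (if m + r + j ≤ m then _ else if m + r + j < m + r then _ else
        z (m + r + j - (m + r))) = z j
      rw [if_neg (by lia), if_neg (by lia), Nat.add_sub_cancel_left]
  refine ⟨y, fun i => ?_, h1, h3⟩
  rcases lt_or_ge i m with hi | hi
  · rw [h1 i hi.le, h1 (i + 1) hi]
    exact hx i
  rcases lt_or_ge i (m + r) with hi' | hi'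
  · obtain ⟨k, rfl⟩ := Nat.exists_eq_add_of_le hi
    rw [h2 k (by lia), add_assoc, h2 (k + 1) (by lia)]
    exact hp k (by lia)
  · obtain ⟨j, rfl⟩ := Nat.exists_eq_add_of_le hi'
    rw [h3, add_assoc, h3]
    exact hz j

/-- Prescribe a letter other than that of `ω` at each multiple of `r` and join them by paths. -/
theorem exists_avoiding (hK : 2 ≤ K) {A : Matrix (Fin K) (Fin K) ℕ} {r : ℕ} (hr : 0 < r)
    (hA : HasPaths A r) (ω : FullShift K) : ∃ z ∈ SFT A, ∀ k, z (r * k) ≠ ω (r * k) := by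
  have : Nontrivial (Fin K) := Fin.nontrivial_iff_two_le.2 hK
  choose c hc using fun k => exists_ne (ω (r * k))
  choose p hp0 hpr hp using hA
  refine ⟨⟨fun i => p (c (i / r)) (c (i / r + 1)) (i % r)⟩, fun i => ?_, fun k => ?_⟩
  · change A (p (c (i / r)) (c (i / r + 1)) (i % r))
      (p (c ((i + 1) / r)) (c ((i + 1) / r + 1)) ((i + 1) % r)) = 1
    have hlt : i % r < r := Nat.mod_lt i hr
    have hi := Nat.div_add_mod i r
    rcases lt_or_ge (i % r + 1) r with h | h
    · obtain ⟨h1, h2⟩ := (Nat.div_mod_unique (a := i + 1) (d := i / r) (c := i % r + 1) hr).2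
        ⟨by lia, h⟩
      rw [h1, h2]
      exact hp _ _ _ hlt
    · obtain ⟨h1, h2⟩ := (Nat.div_mod_unique (a := i + 1) (d := i / r + 1) (c := 0) hr).2
        ⟨by rw [Nat.mul_add]; lia, hr⟩
      rw [h1, h2, hp0]
      have h3 : i % r + 1 = r := by lia
      have := hp (c (i / r)) (c (i / r + 1)) (i % r) hlt
      rwa [h3, hpr] at this
  · change p (c (r * k / r)) (c (r * k / r + 1)) (r * k % r) ≠ ω (r * k)
    rw [Nat.mul_mod_right, hp0, Nat.mul_div_cancel_left k hr]
    exact hc k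

/-! ### Genericity of the mean Li–Yorke property -/

theorem continuous_meanDist (hK : 2 ≤ K) (ω : FullShift K) (n : ℕ) :
    Continuous fun x => meanDist shift ω x n := by
  unfold meanDist
  refine continuous_const.mul (continuous_finsetSum _ fun i _ => ?_)
  exact continuous_const.dist ((continuous_shift hK).iterate i)

theorem dense_of_forall_prefix (hK : 2 ≤ K) {Z : Set (FullShift K)} {Q : FullShift K → Prop}
    (h : ∀ x ∈ Z, ∀ m, ∃ y ∈ Z, (∀ i ≤ m, y i = x i) ∧ Q y) : Dense {x : Z | Q x} := by
  intro x
  rw [mem_closure_iff_nhds]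
  intro U hU
  obtain ⟨V, hV, hVU⟩ := mem_nhds_subtype _ _ _ |>.1 hU
  obtain ⟨m, hm⟩ := exists_cylinder_subset hK hV
  obtain ⟨y, hyZ, hyx, hQ⟩ := h x x.2 m
  exact ⟨⟨y, hyZ⟩, hVU (hm (mem_cylinder_prefixWord.2 fun i hi => hyx i hi.le)), hQ⟩

/-- A point that eventually follows `ω` has mean distance to `ω` tending to `0`. -/
theorem exists_meanDist_lt {ω y : FullShift K} {M : ℕ} (h : ∀ i, M ≤ i → y i = ω i)
    {ε : ℝ} (hε : 0 < ε) (N : ℕ) : ∃ n ≥ N, meanDist shift ω y n < ε := by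
  obtain ⟨q, hq⟩ := exists_nat_gt (M / ε)
  refine ⟨max N (max q (M + 1)), le_max_left _ _, ?_⟩
  set n := max N (max q (M + 1)) with hn
  have hMn : M ≤ n := by lia
  have hqn : (q : ℝ) ≤ n := by exact_mod_cast (by lia : q ≤ n)
  have hn0 : (0 : ℝ) < n := by exact_mod_cast (by lia : 0 < n)
  have hsum : ∑ i ∈ Finset.range n, dist (shift^[i] ω) (shift^[i] y) ≤ M := by
    calc ∑ i ∈ Finset.range n, dist (shift^[i] ω) (shift^[i] y)
        = ∑ i ∈ Finset.range M, dist (shift^[i] ω) (shift^[i] y) := by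
          refine (Finset.sum_subset (Finset.range_mono hMn) fun i _ hi => ?_).symm
          rw [dist_eq_zero]
          ext j : 2
          rw [shift_iterate_apply, shift_iterate_apply, h]
          simp only [Finset.mem_range] at hi
          lia
      _ ≤ ∑ i ∈ Finset.range M, (1 : ℝ) := Finset.sum_le_sum fun _ _ => dist_le_one _ _
      _ = M := by simp
  rw [meanDist, one_div, inv_mul_lt_iff₀ hn0]
  rw [div_lt_iff₀ hε] at hq
  calc _ ≤ (M : ℝ) := hsum
    _ < q * ε := hq
    _ ≤ n * ε := by gcongr

/-- A point that differs from `ω` at all places `M + r k` keeps a mean distance of about `1 / r`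
from `ω`. -/
theorem exists_lt_meanDist {ω y : FullShift K} {M r : ℕ} (hr : 0 < r)
    (h : ∀ k, y (M + r * k) ≠ ω (M + r * k)) (N : ℕ) :
    ∃ n ≥ N, 1 / ((r : ℝ) + 2) < meanDist shift ω y n := by
  classical
  set q := max M N + 1 with hq
  -- with `q > M` differences in `M + r q < (r + 2) q` places
  refine ⟨M + r * q, by nlinarith [le_max_left M N, le_max_right M N], ?_⟩
  have hcard : q ≤ ((Finset.range (M + r * q)).filter fun i => y i ≠ ω i).card := by
    have hinj : Function.Injective fun k => M + r * k := fun a b hab => by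
      simpa [hr.ne'] using hab
    calc q = ((Finset.range q).image fun k => M + r * k).card := by
          rw [Finset.card_image_of_injective _ hinj, Finset.card_range]
      _ ≤ _ := by
          refine Finset.card_le_card fun i hi => ?_
          obtain ⟨k, hk, rfl⟩ := Finset.mem_image.1 hi
          have hkq := Finset.mem_range.1 hk
          refine Finset.mem_filter.2 ⟨Finset.mem_range.2 ?_, h k⟩
          have := Nat.mul_lt_mul_of_pos_left hkq hr
          lia
  have hsum : (q : ℝ) ≤ ∑ i ∈ Finset.range (M + r * q), dist (shift^[i] ω) (shift^[i] y) :=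
    le_trans (by exact_mod_cast hcard) (card_ne_le_sum_dist ω y _)
  have hMq : (M : ℝ) < q := by exact_mod_cast (by lia : M < q)
  have hq0 : (0 : ℝ) < q := lt_of_le_of_lt (Nat.cast_nonneg M) hMq
  have hn0 : (0 : ℝ) < (M + r * q : ℕ) := by push_cast; positivity
  rw [meanDist, one_div, one_div, lt_inv_mul_iff₀ hn0, ← div_eq_mul_inv, div_lt_iff₀ (by positivity)]
  calc ((M + r * q : ℕ) : ℝ) < q * (r + 2) := by push_cast; nlinarith
    _ ≤ _ := by gcongr

/-- The conditions `liminf = 0` and `limsup ≥ 1 / (r + 2)` hold on countable intersections of open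
sets; gluing a prefix of a given point to `ω`, or to a point that avoids `ω`, shows that these open
sets are dense. -/
theorem exists_dense_Gδ_subset_ML (hK : 2 ≤ K) {A : Matrix (Fin K) (Fin K) ℕ} {r : ℕ} (hr : 0 < r)
    (hA : HasPaths A r) {ω : FullShift K} (hω : ω ∈ SFT A) :
    ∃ D : Set (SFT A), IsGδ D ∧ Dense D ∧ ∀ x ∈ D, (x : FullShift K) ∈ ML A ω := by
  have : CompactSpace (SFT A) := isCompact_iff_compactSpace.1 (isCompact_SFT hK A)
  let G : ℕ → Set (SFT A) := fun N => {x | ∃ n ≥ N, meanDist shift ω x n < 1 / ((N : ℝ) + 1)}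
  let H : ℕ → Set (SFT A) := fun N => {x | ∃ n ≥ N, 1 / ((r : ℝ) + 2) < meanDist shift ω x n}
  have hcont : ∀ n, Continuous fun x : SFT A => meanDist shift ω (x : FullShift K) n := fun n =>
    (continuous_meanDist hK ω n).comp continuous_subtype_val
  have hGo : ∀ N, IsOpen (G N) := fun N => by
    simp only [G, ofPred_exists, ← exists_prop, ge_iff_le]
    exact isOpen_iUnion fun n => isOpen_iUnion fun _ => isOpen_lt (hcont n) continuous_const
  have hHo : ∀ N, IsOpen (H N) := fun N => by
    simp only [H, ofPred_exists, ← exists_prop, ge_iff_le]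
    exact isOpen_iUnion fun n => isOpen_iUnion fun _ => isOpen_lt continuous_const (hcont n)
  have hGd : ∀ N, Dense (G N) := fun N => by
    refine dense_of_forall_prefix hK (Q := fun x => ∃ n ≥ N,
      meanDist shift ω x n < 1 / ((N : ℝ) + 1)) fun x hx m => ?_
    obtain ⟨y, hy, hyx, hyω⟩ := exists_glue hA hx (shift_iterate_mem_SFT hω (m + r)) m
    refine ⟨y, hy, hyx, exists_meanDist_lt (M := m + r) (fun i hi => ?_) (by positivity) N⟩
    obtain ⟨j, rfl⟩ := Nat.exists_eq_add_of_le hi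
    rw [hyω, shift_iterate_apply]
  have hHd : ∀ N, Dense (H N) := fun N => by
    refine dense_of_forall_prefix hK (Q := fun x => ∃ n ≥ N,
      1 / ((r : ℝ) + 2) < meanDist shift ω x n) fun x hx m => ?_
    obtain ⟨z, hz, hzω⟩ := exists_avoiding hK hr hA (shift^[m + r] ω)
    obtain ⟨y, hy, hyx, hyz⟩ := exists_glue hA hx hz m
    refine ⟨y, hy, hyx, exists_lt_meanDist (M := m + r) hr (fun k => ?_) N⟩
    rw [hyz, ← shift_iterate_apply]
    exact hzω k
  refine ⟨(⋂ N, G N) ∩ ⋂ N, H N, (IsGδ.iInter_of_isOpen hGo).inter (IsGδ.iInter_of_isOpen hHo),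
    (dense_iInter_of_isOpen hGo hGd).inter_of_Gδ (IsGδ.iInter_of_isOpen hGo)
      (IsGδ.iInter_of_isOpen hHo) (dense_iInter_of_isOpen hHo hHd), fun x hx => ⟨x.2, ?_, ?_⟩⟩
  · refine le_antisymm (le_of_forall_pos_le_add fun ε hε => ?_) ?_
    · obtain ⟨q, hq⟩ := exists_nat_one_div_lt hε
      rw [zero_add]
      refine liminf_le_of_frequently_le (frequently_atTop.2 fun N => ?_)
        (isBoundedUnder_ge_meanDist ω x)
      obtain ⟨n, hn, hlt⟩ := mem_iInter.1 hx.1 (max N q)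
      refine ⟨n, (le_max_left _ _).trans hn, hlt.le.trans (le_trans ?_ hq.le)⟩
      refine one_div_le_one_div_of_le (by positivity) ?_
      gcongr
      exact le_max_right _ _
    · exact le_liminf_of_le (isBoundedUnder_le_meanDist ω x).isCoboundedUnder_ge
        (Eventually.of_forall (meanDist_nonneg ω x))
  · refine lt_of_lt_of_le (by positivity : (0 : ℝ) < 1 / ((r : ℝ) + 2)) ?_
    refine le_limsup_of_frequently_le (frequently_atTop.2 fun N => ?_)
      (isBoundedUnder_le_meanDist ω x)
    obtain ⟨n, hn, hlt⟩ := mem_iInter.1 hx.2 N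
    exact ⟨n, hn, hlt.le⟩

/-! ### Packing entropy of the mean Li–Yorke set -/

/-- Below the entropy, the packing premeasure of a set is infinite as soon as the set is dense in
some cylinder of `Σ_A`: cylinders are open, so they meet the set whenever they meet its closure,
and by gluing the cylinder contains as many words as `Σ_A` up to a shift in length. -/
theorem packingLim_eq_top (hK : 2 ≤ K) {A : Matrix (Fin K) (Fin K) ℕ} {r : ℕ}
    (hA : HasPaths A r) {x : FullShift K} (hx : x ∈ SFT A) {m : ℕ} {Y : Set (FullShift K)}
    (hY : cylinder (prefixWord m x) ∩ SFT A ⊆ closure Y) {s : ℝ≥0}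
    (hs : ((s : ℝ) : EReal) < topEntropy (SFT A)) : packingLim s Y = ⊤ := by
  refine iInf_eq_top.2 fun N => ENNReal.eq_top_of_forall_nnreal_le fun B => ?_
  obtain ⟨n, hn, hcount⟩ : ∃ n ≥ N,
      (B : ℝ) * Real.exp (s * (m + r : ℕ)) * Real.exp (s * n) <
        ((language n (SFT A)).ncard : ℝ) := by
    by_contra! hcon
    exact hs.not_ge (topEntropy_le hK (eventually_atTop.2 ⟨N, hcon⟩))
  set 𝒲 := language (m + r + n) (cylinder (prefixWord m x) ∩ SFT A) with h𝒲
  have hlen : ∀ W ∈ 𝒲, W.length = m + r + n := fun W hW => length_of_mem_language hW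
  have hcard : (language n (SFT A)).ncard ≤ 𝒲.ncard := by
    have hsub : language n (SFT A) ⊆ (fun W => W.drop (m + r)) '' 𝒲 := by
      rintro _ ⟨z, hz, rfl⟩
      obtain ⟨y, hy, hyx, hyz⟩ := exists_glue hA hx hz m
      refine ⟨prefixWord (m + r + n) y,
        ⟨y, ⟨mem_cylinder_prefixWord.2 fun i hi => hyx i hi.le, hy⟩, rfl⟩, ?_⟩
      have h1 : shift^[m + r] y = z := by
        ext j : 2
        rw [shift_iterate_apply, hyz]
      simp only [prefixWord_add (m + r) n, h1]
      rw [List.drop_left' (length_prefixWord _ _)]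
    exact (ncard_le_ncard hsub ((finite_language _ _).image _)).trans
      (ncard_image_le (finite_language _ _))
  refine le_trans ?_ (le_iSup_of_le 𝒲 (le_iSup_of_le (fun W hW => ⟨?_, ?_⟩)
    (le_iSup_of_le ?_ le_rfl)))
  · rw [tsum_weight_of_length hlen, ← ENNReal.ofReal_coe_nnreal, ← ENNReal.ofReal_natCast,
      ← ENNReal.ofReal_mul (Nat.cast_nonneg _)]
    refine ENNReal.ofReal_le_ofReal ?_
    calc (B : ℝ) = B * Real.exp (s * (m + r : ℕ)) * Real.exp (s * n) *
          Real.exp (-((s : ℝ) * (m + r + n : ℕ))) := by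
          rw [mul_assoc, mul_assoc, ← Real.exp_add, ← Real.exp_add]
          push_cast
          ring_nf
          simp
      _ ≤ (𝒲.ncard : ℝ) * Real.exp (-((s : ℝ) * (m + r + n : ℕ))) := by
          gcongr
          exact hcount.le.trans (by exact_mod_cast hcard)
  · rw [hlen W hW]
    lia
  · obtain ⟨y, hyW, hy⟩ := cylinder_inter_nonempty hW
    exact mem_closure_iff.1 (hY hy) _ (isOpen_cylinder hK W) hyW
  · intro V hV W hW hVW
    refine Set.disjoint_left.2 fun y hyV hyW => hVW (eq_of_cylinder_inter ?_ hyV hyW)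
    rw [hlen V hV, hlen W hW]

theorem topEntropy_le_packingEntropy_ML (hK : 2 ≤ K) {A : Matrix (Fin K) (Fin K) ℕ} {r : ℕ}
    (hr : 0 < r) (hA : HasPaths A r) {ω : FullShift K} (hω : ω ∈ SFT A) :
    topEntropy (SFT A) ≤ (packingEntropy (ML A ω) : EReal) := by
  refine EReal.le_of_forall_lt_iff_le.1 fun s hs => ?_
  have hs0 : 0 ≤ s := by
    have := (EReal.coe_ennreal_nonneg (packingEntropy (ML A ω))).trans_lt hs
    exact_mod_cast this.le
  lift s to ℝ≥0 using hs0
  rw [← EReal.coe_nnreal_eq_coe_real, EReal.coe_ennreal_lt_coe_ennreal_iff] at hs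
  simp only [packingEntropy, iInf_lt_iff, exists_prop] at hs
  obtain ⟨t, ht, hts⟩ := hs
  have hts' : ((t : ℝ) : EReal) ≤ ((s : ℝ) : EReal) := by
    exact_mod_cast (by exact_mod_cast hts.le : t ≤ s)
  refine le_trans ?_ hts'
  by_contra! htop
  obtain ⟨Y, hcov, hsum⟩ : ∃ Y : ℕ → Set (FullShift K), ML A ω ⊆ (⋃ i, Y i) ∧
      ∑' i, packingLim t (Y i) < 1 := by
    have h0 : packingMeasure t (ML A ω) < 1 := by
      rw [ht]
      exact one_pos
    simpa only [packingMeasure, iInf_lt_iff, exists_prop] using h0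
  have : CompactSpace (SFT A) := isCompact_iff_compactSpace.1 (isCompact_SFT hK A)
  have : Nonempty (SFT A) := ⟨⟨ω, hω⟩⟩
  obtain ⟨D, hDG, hDd, hDML⟩ := exists_dense_Gδ_subset_ML hK hr hA hω
  have hdense := hDG.dense_iUnion_interior_of_closed hDd
    (f := fun i => (Subtype.val : SFT A → FullShift K) ⁻¹' closure (Y i))
    (fun i => isClosed_closure.preimage continuous_subtype_val) fun x hx => by
      obtain ⟨i, hi⟩ := mem_iUnion.1 (hcov (hDML x hx))
      exact mem_iUnion.2 ⟨i, subset_closure hi⟩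
  obtain ⟨x, hx⟩ := hdense.nonempty
  obtain ⟨i, hi⟩ := mem_iUnion.1 hx
  obtain ⟨V, hV, hVY⟩ := mem_nhds_subtype _ _ _ |>.1 (mem_interior_iff_mem_nhds.1 hi)
  obtain ⟨m, hm⟩ := exists_cylinder_subset hK hV
  have hinf := packingLim_eq_top hK hA x.2 (m := m) (Y := Y i)
    (fun y hy => hVY (a := ⟨y, hy.2⟩) (hm hy.1)) htop
  exact ((ENNReal.le_tsum i).trans_lt hsum).not_ge (hinf ▸ le_top)

/-! ### Dimension of the mean Li–Yorke set -/

/-- A one-letter alphabet carries a single point, and no mean Li–Yorke pairs. -/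
theorem ML_eq_empty_of_subsingleton [Subsingleton (FullShift K)] (A : Matrix (Fin K) (Fin K) ℕ)
    (ω : FullShift K) : ML A ω = ∅ := by
  refine eq_empty_of_forall_notMem fun x hx => ?_
  have h := hx.2.2
  rw [Subsingleton.elim x ω] at h
  have h0 : meanDist shift ω ω = fun _ => 0 := by
    funext n
    simp [meanDist]
  rw [h0, limsup_const] at h
  exact lt_irrefl _ h

theorem topEntropy_of_subsingleton [Subsingleton (FullShift K)] {Z : Set (FullShift K)}
    (h : Z.Nonempty) : topEntropy Z = 0 := by
  refine le_antisymm (iSup₂_le fun U hU => ?_) (Dynamics.coverEntropy_nonneg _ h)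
  have : U = univ := eq_univ_of_forall fun p => by
    have := refl_mem_uniformity (x := p.1) hU
    rwa [show p = (p.1, p.1) from Prod.ext rfl (Subsingleton.elim _ _)]
  rw [this]
  exact (Dynamics.coverEntropyEntourage_univ _ h).le

theorem packingEntropy_empty : packingEntropy (∅ : Set (FullShift K)) = 0 := by
  refine le_antisymm (iInf₂_le_of_le 0 (le_antisymm ?_ zero_le) le_rfl) zero_le
  refine (packingMeasure_le_packingLim 0 ∅).trans_eq (packingLim_eq_zero ?_)
  simp [language]

theorem dimP_empty {X : Type*} [MetricSpace X] : dimP (∅ : Set X) = 0 := by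
  refine le_antisymm (iInf₂_le_of_le 0 (le_antisymm ?_ zero_le) le_rfl) zero_le
  refine iInf₂_le_of_le (fun _ => ∅) (empty_subset _) ?_
  have h : ballPackingLim 0 (∅ : Set X) = 0 := by
    refine le_antisymm (iInf₂_le_of_le 1 one_pos ?_) zero_le
    refine iSup_le fun ℬ => iSup_le fun hℬ => iSup_le fun _ => ?_
    have : ℬ = ∅ := eq_empty_of_forall_notMem fun b hb => (hℬ b hb).1
    rw [this]
    simp
  simp [h]

end Shift

theorem theorem7p2 {K : ℕ} (A : Matrix (Fin K) (Fin K) ℕ) (hA01 : ∀ i j, A i j = 0 ∨ A i j = 1)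
    (hA : Shift.IsAperiodicIrreducible A) (ω : Shift.FullShift K) (hω : ω ∈ Shift.SFT A) :
    Shift.bowenEntropy (Shift.ML A ω) = 0 ∧
    (Shift.packingEntropy (Shift.ML A ω) : EReal) = Shift.topEntropy (Shift.SFT A) ∧
    dimH (Shift.ML A ω) = 0 ∧
    Shift.dimP (Shift.ML A ω) = dimH (Shift.SFT A) := by
  have hB := Shift.bowenEntropy_ML A ω
  refine ⟨hB, ?_⟩
  rcases (Shift.one_le_card ω).eq_or_lt' with hK | hK
  · subst hK
    have : Subsingleton (Shift.FullShift 1) :=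
      ⟨fun x y => Shift.FullShift.ext (Subsingleton.elim _ _)⟩
    rw [Shift.ML_eq_empty_of_subsingleton, Shift.packingEntropy_empty,
      Shift.topEntropy_of_subsingleton ⟨ω, hω⟩, dimH_empty, Shift.dimP_empty,
      dimH_subsingleton Set.subsingleton_of_subsingleton]
    simp
  have hK2 : 2 ≤ K := hK
  obtain ⟨r, hr, hpos⟩ := hA
  have hpath : Shift.HasPaths A r := fun i j => Shift.exists_path_of_pow_pos hA01 r i j (hpos i j)
  have hP : (Shift.packingEntropy (Shift.ML A ω) : EReal) = Shift.topEntropy (Shift.SFT A) :=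
    le_antisymm (Shift.packingEntropy_le_topEntropy (fun x hx => hx.1)
      (Dynamics.coverEntropy_nonneg _ ⟨ω, hω⟩))
      (Shift.topEntropy_le_packingEntropy_ML hK2 hr hpath hω)
  have hl0 : (Shift.logCard K : ENNReal) ≠ 0 := by
    exact_mod_cast (Shift.logCard_pos hK2).ne'
  refine ⟨hP, ?_, ?_⟩
  · have h := Shift.dimH_mul_logCard hK2 (Shift.ML A ω)
    rw [hB] at h
    exact (mul_eq_zero.1 h).resolve_right hl0
  · rw [← ENNReal.mul_left_inj hl0 ENNReal.coe_ne_top, Shift.dimP_mul_logCard hK2,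
      Shift.dimH_mul_logCard hK2, ← EReal.coe_ennreal_eq_coe_ennreal_iff, hP]
    exact (Shift.bowenEntropy_eq_topEntropy hK2 (Shift.isCompact_SFT hK2 A)
      (fun x hx k => Shift.shift_iterate_mem_SFT hx k) ⟨ω, hω⟩).symm
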